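/- Let $\omega>0$ and $Q>0$, and put $\rho_0=1$, $\rho_{2l-1}=\rho_{2l}=e^{l^2\omega^2/2}$ for $l\ge 1$. Let $\phi_0(t)=(2\pi)^{-1/2}$, $\phi_{2l-1}(t)=\pi^{-1/2}\sin(lt)$, $\phi_{2l}(t)=\pi^{-1/2}\cos(lt)$ be the trigonometric basis of $L_2(-\pi,\pi)$, and let $$H^\infty_\omega(Q)=\Big\{f:\ f(t)=\sum_{l=0}^\infty\theta_l\phi_l(t),\ \sum_{l=0}^\infty\rho_l\theta_l^2\le Q\Big\}$$ be the infinite-order Sobolev ellipsoid; it is identified with the set of the coefficient sequences $\theta=(\theta_l)_{l\ge 0}$ with $\sum_l\rho_l\theta_l^2\le Q$, where $\theta_l=\int_{-\pi}^{\pi}f(t)\phi_l(t)\,dt$. In the Gaussian sequence model one observes $y_l=\theta_l+\varepsilon_l$, $l=0,1,\dots$, with $\varepsilon_l$ independent $N(0,1/n)$. In the white noise model one observes the path $Y_n(t)=\int_{-\pi}^t f(u)\,du+n^{-1/2}B(t)$, $t\in[-\pi,\pi]$, where $B$ is a standard Brownian motion on $[-\pi,\pi]$ with $B(-\pi)=0$.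 Then, in each of these two models, $$\inf_{\bar\theta}\ \sup_{\theta\in H^\infty_\omega(Q)}\ \sum_{l=0}^\infty E(\bar\theta_l-\theta_l)^2\ \sim\ 2\sqrt2\,\omega^{-1}n^{-1}(\log n)^{1/2}\qquad(n\to\infty),$$ where the infimum is over all estimators $\bar\theta=(\bar\theta_l)_{l\ge0}$, that is, all measurable functions of the observation, and $a_n\sim b_n$ means $a_n/b_n\to1$. In particular the asymptotic minimax risk does not depend on $Q$. -/

import Mathlib

open MeasureTheory ProbabilityTheory Filter Topology
open scoped NNReal ENNReal

noncomputable section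

namespace InfSobolev

/-- The frequency of the `l`-th trigonometric basis function:
`freq 0 = 0` and `freq (2 * k - 1) = freq (2 * k) = k` for `k ≥ 1`. -/
def freq (l : ℕ) : ℕ := (l + 1) / 2

/-- The weights `ρ_0 = 1`, `ρ_{2k-1} = ρ_{2k} = exp (k² ω² / 2)`. -/
def weight (ω : ℝ) (l : ℕ) : ℝ := Real.exp ((freq l : ℝ) ^ 2 * ω ^ 2 / 2)

/-- The classical trigonometric orthonormal basis of `L²(-π, π)`:
`φ_0 = (2π)^{-1/2}`, `φ_{2k-1}(t) = π^{-1/2} sin (k t)`, `φ_{2k}(t) = π^{-1/2} cos (k t)`. -/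
def trigBasis (l : ℕ) (t : ℝ) : ℝ :=
  if l = 0 then (√(2 * Real.pi))⁻¹
  else if Odd l then (√Real.pi)⁻¹ * Real.sin (freq l * t)
  else (√Real.pi)⁻¹ * Real.cos (freq l * t)

/-- The Fourier coefficient `θ_l = (f, φ_l) = ∫_{-π}^{π} f(t) φ_l(t) dt`. -/
def fourierCoef (f : ℝ → ℝ) (l : ℕ) : ℝ :=
  ∫ t in (-Real.pi)..Real.pi, f t * trigBasis l t

/-- The ellipsoid `{θ : ∑ ρ_l θ_l² ≤ Q}` of coefficient sequences. -/
def coefEllipsoid (ω Q : ℝ) : Set (ℕ → ℝ) :=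
  {θ | Summable (fun l => weight ω l * θ l ^ 2) ∧ ∑' l, weight ω l * θ l ^ 2 ≤ Q}

/-- The infinite-order Sobolev ellipsoid `H^∞_ω(Q)` of (`2π`-periodic) functions
`f = ∑ θ_l φ_l` with `∑ ρ_l θ_l² ≤ Q`. -/
def sobolevEllipsoid (ω Q : ℝ) : Set (ℝ → ℝ) :=
  {f | ∃ θ ∈ coefEllipsoid ω Q, ∀ t, HasSum (fun l => θ l * trigBasis l t) (f t)}

/-! ### The Gaussian sequence model -/

/-- The law of the data `y_l = θ_l + ε_l`, `l = 0, 1, …`, with `ε_l` independent `N(0, 1/n)`. -/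
def sequenceLaw (n : ℕ) (θ : ℕ → ℝ) : Measure (ℕ → ℝ) :=
  Measure.infinitePi fun l => gaussianReal (θ l) ((n : ℝ≥0)⁻¹)

/-- The risk `∑_l E (θ̄_l - θ_l)²` of the estimator `T` at `θ` in the sequence model. -/
def sequenceRisk (n : ℕ) (T : (ℕ → ℝ) → ℕ → ℝ) (θ : ℕ → ℝ) : ℝ≥0∞ :=
  ∑' l, ∫⁻ y, ENNReal.ofReal ((T y l - θ l) ^ 2) ∂(sequenceLaw n θ)

/-- The minimax risk over the ellipsoid in the sequence model; the infimum is over all estimators,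
that is, over all measurable functions of the data. -/
def sequenceMinimaxRisk (ω Q : ℝ) (n : ℕ) : ℝ≥0∞ :=
  ⨅ (T : (ℕ → ℝ) → ℕ → ℝ) (_ : Measurable T), ⨆ θ ∈ coefEllipsoid ω Q, sequenceRisk n T θ

/-! ### The white noise model -/

/-- The observed path `Y_n(t) = ∫_{-π}^t f(u) du + n^{-1/2} B(t)`, `t ∈ [-π, π]`. The Brownian
motion on `[-π, π]`, started at `-π`, is `t ↦ B (t + π)` for a Brownian motion `B` on `[0, ∞)`. -/
def whiteNoisePath {Ω : Type*} (B : ℝ≥0 → Ω → ℝ) (n : ℕ) (f : ℝ → ℝ) (w : Ω) :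
    Set.Icc (-Real.pi) Real.pi → ℝ :=
  fun t => (∫ u in (-Real.pi)..(t : ℝ), f u) + (√(n : ℝ))⁻¹ * B (Real.toNNReal (t + Real.pi)) w

/-- The risk `∑_l E (θ̄_l - θ_l)²`, with `θ_l` the Fourier coefficients of `f`, of the estimator
`T` (a function of the whole observed path) at `f` in the white noise model. -/
def whiteNoiseRisk {Ω : Type*} [MeasurableSpace Ω] (P : Measure Ω) (B : ℝ≥0 → Ω → ℝ) (n : ℕ)
    (T : (Set.Icc (-Real.pi) Real.pi → ℝ) → ℕ → ℝ) (f : ℝ → ℝ) : ℝ≥0∞ :=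
  ∑' l, ∫⁻ w, ENNReal.ofReal ((T (whiteNoisePath B n f w) l - fourierCoef f l) ^ 2) ∂P

/-- The minimax risk over `H^∞_ω(Q)` in the white noise model; the infimum is over all estimators,
that is, over all measurable functions of the observed path. -/
def whiteNoiseMinimaxRisk {Ω : Type*} [MeasurableSpace Ω] (P : Measure Ω) (B : ℝ≥0 → Ω → ℝ)
    (ω Q : ℝ) (n : ℕ) : ℝ≥0∞ :=
  ⨅ (T : (Set.Icc (-Real.pi) Real.pi → ℝ) → ℕ → ℝ) (_ : Measurable T),
    ⨆ f ∈ sobolevEllipsoid ω Q, whiteNoiseRisk P B n T f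

/-- The rate `2 √2 ω⁻¹ n⁻¹ (log n)^{1/2}`. -/
def rate (ω : ℝ) (n : ℕ) : ℝ :=
  2 * √2 * ω⁻¹ * (n : ℝ)⁻¹ * √(Real.log n)

end InfSobolev

end

/-!
Both models are Gaussian shift experiments: one observes `∑ j, θ j • v j + X`, where `X` is a centred
Gaussian process (the noise coordinates, or `n^{-1/2} B` on `[-π, π]`) and `v j` is a direction
(the `j`-th unit vector, or the primitive of the `j`-th basis function) whose squared norm in the
reproducing kernel Hilbert space of `X` is at most `n`. The weights `exp (k² ω² / 2)` grow so fast
that essentially only the coefficients with `weight ≤ n` matter. There are about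
`2 √(2 log n) / ω` of them, two for each frequency, and each costs `1 / n`, whatever `Q` is.

*Upper bound.* Estimate the first `N` coefficients by the data (in the white noise model: by Riemann
sums of `∫ φ_l dY`, which are honest functions of the path and whose mesh can be taken to zero for
fixed `n`), and the others by zero. The risk is at most `N / n + Q / weight N`
(`sequenceMinimaxRisk_upper`, `whiteNoiseMinimaxRisk_upper`).

*Lower bound.* The ellipsoid contains a cube in the first `N` coordinates, of half-width
`√(Q / (N weight N))`, which is much larger than `n^{-1/2}` when `weight N ≤ n^{1 - c}`. Under
independent `N(0, L / n)` priors the Bayes risk of each coordinate is at least `1 / (n (1 + 1 / L))`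
(`le_bayesRisk_shift`). This rests on `le_lintegral_sq_sub_of_linear`: in a jointly Gaussian family
the error of the best linear prediction is independent of all the observations, so that the best
linear predictor is the best predictor, for an arbitrary index set of observations. The mass that the
prior puts outside the cube is negligible (`card_mul_le_of_forall_cube_risk_le`).

`tendsto_div_rate` matches the two bounds.
-/

noncomputable section

namespace InfSobolev

/-! ### Gaussian families in `L²` -/

section GaussianClosure

variable {Ω : Type*} [MeasurableSpace Ω] {P : Measure Ω}

lemma coeFn_sum_smul_ae_eq {T : Type*} {U : T → Lp ℝ 2 P} {W : T → Ω → ℝ}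
    (hU : ∀ t, U t =ᵐ[P] W t) (s : Finset T) (c : T → ℝ) :
    (∑ t ∈ s, c t • U t : Lp ℝ 2 P) =ᵐ[P] fun w => ∑ t ∈ s, c t * W t w := by
  classical
  induction s using Finset.induction_on with
  | empty =>
    filter_upwards [Lp.coeFn_zero ℝ 2 P] with w hw
    simpa using hw
  | insert t s ht ih =>
    rw [Finset.sum_insert ht]
    filter_upwards [ih, Lp.coeFn_add (c t • U t) (∑ t ∈ s, c t • U t), Lp.coeFn_smul (c t) (U t),
      hU t] with w h1 h2 h3 h4
    rw [h2, Pi.add_apply, h1, h3, Finset.sum_insert ht, Pi.smul_apply, h4, smul_eq_mul]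

/-- Finitely many variables are jointly Gaussian if all their linear combinations are Gaussian. -/
lemma hasGaussianLaw_of_forall_sum {I : Type*} [Fintype I] [IsProbabilityMeasure P]
    {X : I → Ω → ℝ} (hm : ∀ i, AEMeasurable (X i) P)
    (h : ∀ c : I → ℝ, HasGaussianLaw (fun w => ∑ i, c i * X i w) P) :
    HasGaussianLaw (fun w i => X i w) P := by
  classical
  have hm' : AEMeasurable (fun w i => X i w) P := aemeasurable_pi_lambda _ hm
  refine ⟨⟨fun L => ?_⟩⟩
  have hL : (fun w => L (fun i => X i w)) = fun w => ∑ i, L (Pi.single i 1) * X i w := by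
    ext w
    conv_lhs => rw [← Finset.univ_sum_single (fun i => X i w), map_sum]
    refine Finset.sum_congr rfl fun i _ => ?_
    have : (Pi.single i (X i w) : I → ℝ) = X i w • (Pi.single i 1 : I → ℝ) := by
      rw [← Pi.single_smul]; simp
    rw [this, map_smul, smul_eq_mul, mul_comm]
  have h1 := (h fun i => L (Pi.single i 1)).map_eq_gaussianReal
  rw [← hL] at h1
  rw [AEMeasurable.map_map_of_aemeasurable (by fun_prop) hm', integral_map hm' (by fun_prop),
    variance_map (by fun_prop) hm']
  exact h1

/-- The set of Gaussian variables is closed in `L²`: the characteristic function, the mean and the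
variance of an element of `L²` all depend continuously on it. -/
lemma hasGaussianLaw_of_tendsto_Lp [IsProbabilityMeasure P] {f : ℕ → Lp ℝ 2 P} {g : Lp ℝ 2 P}
    (hf : ∀ k, HasGaussianLaw (f k) P) (hfg : Tendsto f atTop (𝓝 g)) : HasGaussianLaw g P := by
  have hae : TendstoInMeasure P (fun k => (f k : Ω → ℝ)) atTop g :=
    tendstoInMeasure_of_tendsto_Lp hfg
  obtain ⟨ns, hns, hlim⟩ := hae.exists_seq_tendsto_ae
  have hgm : AEMeasurable g P := (Lp.aestronglyMeasurable g).aemeasurable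
  have hmean : ∀ h : Lp ℝ 2 P, P[h] = inner ℝ (Lp.const 2 P (1 : ℝ)) h := fun h => by
    rw [L2.inner_def]
    refine integral_congr_ae ?_
    filter_upwards [Lp.coeFn_const (p := 2) (μ := P) (1 : ℝ)] with w hw
    rw [hw]; simp
  have hvar : ∀ h : Lp ℝ 2 P,
      Var[h; P] = ‖h‖ ^ 2 - (inner ℝ (Lp.const 2 P (1 : ℝ)) h) ^ 2 := fun h => by
    have e : ‖h‖ ^ 2 = P[(h : Ω → ℝ) ^ 2] := by
      rw [← real_inner_self_eq_norm_sq h, L2.inner_def]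
      simp only [sq, Pi.mul_apply, RCLike.inner_apply, conj_trivial]
    rw [variance_eq_sub (Lp.memLp h), hmean, e]
  have hfg' : Tendsto (fun k => f (ns k)) atTop (𝓝 g) := hfg.comp hns.tendsto_atTop
  rw [hasGaussianLaw_iff_charFun_map_eq hgm]
  intro t
  have h1 : Tendsto (fun k => charFun (P.map (f (ns k))) t) atTop (𝓝 (charFun (P.map g) t)) := by
    simp only [charFun_apply_real]
    have e : ∀ h : Lp ℝ 2 P, ∫ x, Complex.exp (t * x * Complex.I) ∂(P.map h)
        = ∫ w, Complex.exp (t * h w * Complex.I) ∂P := fun h =>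
      integral_map (Lp.aestronglyMeasurable h).aemeasurable (by fun_prop)
    simp only [e]
    refine tendsto_integral_of_dominated_convergence (fun _ => 1) ?_ (by simp) ?_ ?_
    · intro k
      have := (Lp.aestronglyMeasurable (f (ns k)))
      exact (by fun_prop : Continuous fun x : ℝ =>
        Complex.exp (t * x * Complex.I)).comp_aestronglyMeasurable this
    · intro k
      refine ae_of_all _ fun w => ?_
      rw [← Complex.ofReal_mul, Complex.norm_exp_ofReal_mul_I]
    · filter_upwards [hlim] with w hw
      exact ((by fun_prop : Continuous fun x : ℝ =>
        Complex.exp (t * x * Complex.I)).tendsto _).comp hw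
  refine tendsto_nhds_unique h1 ?_
  have hm : ∀ h : Lp ℝ 2 P, P[fun w => inner ℝ t (h w)] = t * inner ℝ (Lp.const 2 P (1 : ℝ)) h :=
    fun h => by
      rw [← hmean, ← integral_const_mul]; simp [mul_comm]
  have hv : ∀ h : Lp ℝ 2 P, Var[fun w => inner ℝ t (h w); P]
      = t ^ 2 * (‖h‖ ^ 2 - (inner ℝ (Lp.const 2 P (1 : ℝ)) h) ^ 2) := fun h => by
    rw [← hvar, ← variance_const_mul]; simp [mul_comm]
  have h2 : ∀ k, charFun (P.map (f (ns k))) t = _ := fun k => (hf (ns k)).charFun_map_eq t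
  simp only [h2, hm, hv]
  have hcont : Continuous fun h : Lp ℝ 2 P =>
      Complex.exp (((t * inner ℝ (Lp.const 2 P (1 : ℝ)) h : ℝ) : ℂ) * Complex.I
        - ((t ^ 2 * (‖h‖ ^ 2 - (inner ℝ (Lp.const 2 P (1 : ℝ)) h) ^ 2) : ℝ) : ℂ) / 2) := by
    fun_prop
  exact (hcont.tendsto g).comp hfg'

/-- Variables in the `L²` closure of the linear span of a Gaussian process are jointly Gaussian. -/
lemma isGaussianProcess_of_mem_closure_span {S T : Type*} {W : T → Ω → ℝ}
    (hW : IsGaussianProcess W P) {U : T → Lp ℝ 2 P} (hU : ∀ t, U t =ᵐ[P] W t)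
    {Z : S → Ω → ℝ} {z : S → Lp ℝ 2 P} (hz : ∀ s, z s =ᵐ[P] Z s)
    (hmem : ∀ s, z s ∈ (Submodule.span ℝ (Set.range U)).topologicalClosure) :
    IsGaussianProcess Z P := by
  have := hW.isProbabilityMeasure
  have hspan : ∀ g ∈ Submodule.span ℝ (Set.range U), HasGaussianLaw g P := by
    intro g hg
    obtain ⟨c, rfl⟩ := Finsupp.mem_span_range_iff_exists_finsupp.1 hg
    have h1 : HasGaussianLaw (fun w => ∑ t ∈ c.support, c t * W t w) P :=
      (hW.smul c).hasGaussianLaw_fun_sum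
    exact h1.congr (coeFn_sum_smul_ae_eq hU c.support c).symm
  have hclos : ∀ g ∈ (Submodule.span ℝ (Set.range U)).topologicalClosure, HasGaussianLaw g P := by
    intro g hg
    rw [← SetLike.mem_coe, Submodule.topologicalClosure_coe, mem_closure_iff_seq_limit] at hg
    obtain ⟨x, hx, hlim⟩ := hg
    exact hasGaussianLaw_of_tendsto_Lp (fun k => hspan _ (hx k)) hlim
  refine ⟨fun I => ?_⟩
  have hZm : ∀ s, AEMeasurable (Z s) P := fun s =>
    (Lp.aestronglyMeasurable (z s)).aemeasurable.congr (hz s)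
  refine hasGaussianLaw_of_forall_sum (X := fun (i : I) w => Z i w) (fun i => hZm i) fun c => ?_
  have hg := hclos (∑ i : I, c i • z i) (Submodule.sum_mem _ fun i _ =>
    Submodule.smul_mem _ _ (hmem i))
  exact hg.congr (coeFn_sum_smul_ae_eq (fun i : I => hz i) Finset.univ c)

end GaussianClosure

/-! ### Prediction from jointly Gaussian observations -/

section Bayes

variable {Ω ι : Type*} [MeasurableSpace Ω] {P : Measure Ω}

/-- If `θ` and the observations `Y` are jointly Gaussian and centred, then no measurable function
of `Y` predicts `θ` better than the best linear predictor does: the error of the latter is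
uncorrelated with, hence independent of, `Y`. -/
lemma le_lintegral_sq_sub_of_linear {θ : Ω → ℝ} {Y : ι → Ω → ℝ}
    (hG : IsGaussianProcess (fun o : Option ι => o.elim θ Y) P)
    (hYm : ∀ i, Measurable (Y i)) (hθ0 : P[θ] = 0) (hY0 : ∀ i, P[Y i] = 0) {b : ℝ}
    (hb : ∀ (I : Finset ι) (c : ι → ℝ), b ≤ ∫ w, (θ w - ∑ i ∈ I, c i * Y i w) ^ 2 ∂P)
    {T : (ι → ℝ) → ℝ} (hT : Measurable T) :
    ENNReal.ofReal b ≤ ∫⁻ w, ENNReal.ofReal ((T (fun i => Y i w) - θ w) ^ 2) ∂P := by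
  classical
  have := hG.isProbabilityMeasure
  have hθL : MemLp θ 2 P := (hG.hasGaussianLaw_eval none).memLp_two
  have hYL : ∀ i, MemLp (Y i) 2 P := fun i => (hG.hasGaussianLaw_eval (some i)).memLp_two
  let U : Option ι → Lp ℝ 2 P := fun o => o.elim hθL.toLp (fun i => (hYL i).toLp)
  have hU : ∀ o, U o =ᵐ[P] (fun o : Option ι => o.elim θ Y) o := by
    rintro (_ | i)
    · exact hθL.coeFn_toLp
    · exact (hYL i).coeFn_toLp
  let V := (Submodule.span ℝ (Set.range fun i => U (some i)))
  let K := V.topologicalClosure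
  have : CompleteSpace K := V.isClosed_topologicalClosure.completeSpace_coe
  have hKU : K ≤ (Submodule.span ℝ (Set.range U)).topologicalClosure :=
    Submodule.topologicalClosure_mono (Submodule.span_mono (by rintro _ ⟨i, rfl⟩; exact ⟨_, rfl⟩))
  let p : Lp ℝ 2 P := K.starProjection (U none)
  have hpK : p ∈ K := Submodule.starProjection_apply_mem _ _
  let D : Lp ℝ 2 P := U none - p
  have hDorth : ∀ q ∈ K, inner ℝ q D = 0 := fun q hq =>
    (Submodule.mem_orthogonal _ _).1 (Submodule.sub_starProjection_mem_orthogonal _) q hq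
  have hmemU : ∀ o, U o ∈ (Submodule.span ℝ (Set.range U)).topologicalClosure := fun o =>
    Submodule.le_topologicalClosure _ (Submodule.subset_span ⟨o, rfl⟩)
  -- the prediction error and the observations are jointly Gaussian
  have hproc : IsGaussianProcess (Sum.elim (fun _ : Unit => (D : Ω → ℝ)) Y) P := by
    refine isGaussianProcess_of_mem_closure_span hG hU
      (z := Sum.elim (fun _ => D) fun i => U (some i)) ?_ ?_
    · rintro (_ | i)
      · exact EventuallyEq.rfl
      · exact hU (some i)
    · rintro (_ | i)
      · exact Submodule.sub_mem _ (hmemU _) (hKU hpK)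
      · exact hmemU (some i)
  have hDm : AEMeasurable D P := (Lp.aestronglyMeasurable D).aemeasurable
  have hinner : ∀ q : Lp ℝ 2 P, ∫ w, D w * q w ∂P = inner ℝ q D := fun q => by
    rw [L2.inner_def]; rfl
  have hind : IndepFun (fun w (_ : Unit) => D w) (fun w i => Y i w) P := by
    refine hproc.indepFun_of_covariance_eq_zero (fun _ => hDm)
      (fun i => (hYm i).aemeasurable) fun _ i => ?_
    rw [covariance_eq_sub (Lp.memLp D) (hYL i), hY0 i, mul_zero, sub_zero]
    have : ∫ w, (D * Y i : Ω → ℝ) w ∂P = ∫ w, D w * U (some i) w ∂P := by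
      refine integral_congr_ae ?_
      filter_upwards [hU (some i)] with w hw
      simp only [Pi.mul_apply, hw, Option.elim]
    rw [this, hinner]
    exact hDorth _ (Submodule.le_topologicalClosure _ (Submodule.subset_span ⟨i, rfl⟩))
  -- its mean vanishes
  have hmeanK : ∀ q ∈ (Submodule.span ℝ (Set.range U)).topologicalClosure, P[q] = 0 := by
    have hmean : ∀ h : Lp ℝ 2 P, P[h] = inner ℝ (Lp.const 2 P (1 : ℝ)) h := fun h => by
      rw [L2.inner_def]
      refine integral_congr_ae ?_
      filter_upwards [Lp.coeFn_const (p := 2) (μ := P) (1 : ℝ)] with w hw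
      rw [hw]; simp
    have hle : (Submodule.span ℝ (Set.range U)).topologicalClosure
        ≤ (Submodule.span ℝ {Lp.const 2 P (1 : ℝ)})ᗮ := by
      refine Submodule.topologicalClosure_minimal _ (Submodule.span_le.2 ?_)
        (Submodule.isClosed_orthogonal _)
      rintro _ ⟨o, rfl⟩
      rw [SetLike.mem_coe, Submodule.mem_orthogonal_singleton_iff_inner_right, ← hmean,
        integral_congr_ae (hU o)]
      cases o with
      | none => exact hθ0
      | some i => exact hY0 i
    intro q hq
    rw [hmean]
    exact Submodule.mem_orthogonal_singleton_iff_inner_right.1 (hle hq)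
  have hD0 : P[D] = 0 := hmeanK D (Submodule.sub_mem _ (hmemU _) (hKU hpK))
  -- its second moment is at least `b`
  have hbD : b ≤ ‖D‖ ^ 2 := by
    have hclosed : IsClosed {q : Lp ℝ 2 P | b ≤ ‖U none - q‖ ^ 2} :=
      isClosed_le continuous_const (by fun_prop)
    have hsub : (V : Set (Lp ℝ 2 P)) ⊆ {q : Lp ℝ 2 P | b ≤ ‖U none - q‖ ^ 2} := by
      intro q hq
      obtain ⟨c, rfl⟩ := Finsupp.mem_span_range_iff_exists_finsupp.1 hq
      refine (hb c.support c).trans (le_of_eq ?_)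
      rw [← real_inner_self_eq_norm_sq, L2.inner_def]
      refine integral_congr_ae ?_
      filter_upwards [coeFn_sum_smul_ae_eq (fun i => hU (some i)) c.support c, hU none,
        Lp.coeFn_sub (U none) (c.sum fun i a => a • U (some i))] with w h1 h2 h3
      rw [h3, Pi.sub_apply, h2, Finsupp.sum, h1]
      simp only [sq, RCLike.inner_apply, conj_trivial, Option.elim]
    exact (closure_minimal hsub hclosed) (by
      have := hpK
      rwa [← SetLike.mem_coe, Submodule.topologicalClosure_coe] at this)
  have hDD : ∫ w, D w ^ 2 ∂P = ‖D‖ ^ 2 := by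
    rw [← real_inner_self_eq_norm_sq, ← hinner]; simp [sq]
  have hDθ : ∫ w, D w * θ w ∂P = ‖D‖ ^ 2 := by
    have : ∫ w, D w * θ w ∂P = ∫ w, D w * U none w ∂P := by
      refine integral_congr_ae ?_
      filter_upwards [hU none] with w hw
      simp only [hw, Option.elim]
    rw [this, hinner, ← real_inner_self_eq_norm_sq]
    have h : U none = D + p := by simp [D]
    conv_lhs => rw [h]
    rw [inner_add_left, hDorth p hpK, add_zero]
  have hTY : AEStronglyMeasurable (fun w => T fun i => Y i w) P :=
    (hT.comp (measurable_pi_lambda _ hYm)).aestronglyMeasurable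
  by_cases hfin : ∫⁻ w, ENNReal.ofReal ((T (fun i => Y i w) - θ w) ^ 2) ∂P = ∞
  · rw [hfin]; exact le_top
  have hE : MemLp (fun w => T (fun i => Y i w) - θ w) 2 P := by
    refine (memLp_two_iff_integrable_sq (hTY.sub hθL.aestronglyMeasurable)).2
      ⟨(hTY.sub hθL.aestronglyMeasurable).pow 2, ?_⟩
    rw [hasFiniteIntegral_iff_ofReal (ae_of_all _ fun w => sq_nonneg _)]
    exact lt_top_iff_ne_top.2 hfin
  have hTL : MemLp (fun w => T fun i => Y i w) 2 P := by
    exact (hE.add hθL).ae_eq (ae_of_all _ fun w => by simp)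
  rw [← ofReal_integral_eq_lintegral_ofReal hE.integrable_sq (ae_of_all _ fun w => sq_nonneg _)]
  refine ENNReal.ofReal_le_ofReal (hbD.trans ?_)
  have hDT : ∫ w, D w * T (fun i => Y i w) ∂P = 0 := by
    have hi : IndepFun (D : Ω → ℝ) (fun w => T fun i => Y i w) P :=
      hind.comp (measurable_pi_apply ()) hT
    rw [hi.integral_fun_mul_eq_mul_integral (Lp.aestronglyMeasurable D) hTY, hD0, zero_mul]
  have iDT : Integrable (fun w => D w * T fun i => Y i w) P := (Lp.memLp D).integrable_mul hTL
  have iDθ : Integrable (fun w => D w * θ w) P := (Lp.memLp D).integrable_mul hθL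
  have iDD : Integrable (fun w => D w ^ 2) P := (Lp.memLp D).integrable_sq
  -- integrate `(T - θ)² ≥ 2 D θ - 2 D T - D²`, which is `(T - θ + D)² ≥ 0`
  calc ‖D‖ ^ 2 = ∫ w, (2 * (D w * θ w) - 2 * (D w * T fun i => Y i w) - D w ^ 2) ∂P := by
        have e := integral_sub ((iDθ.const_mul 2).sub (iDT.const_mul 2)) iDD
        simp only [Pi.sub_apply] at e
        rw [e, integral_sub (iDθ.const_mul 2) (iDT.const_mul 2), integral_const_mul,
          integral_const_mul,
          hDθ, hDT, hDD]
        ring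
    _ ≤ _ := by
        refine integral_mono (((iDθ.const_mul 2).sub (iDT.const_mul 2)).sub iDD)
          hE.integrable_sq fun w => ?_
        dsimp only
        nlinarith [sq_nonneg (T (fun i => Y i w) - θ w + D w)]

end Bayes

/-! ### Gaussian shift models -/

section Shift

variable {Ω ι : Type*} [MeasurableSpace Ω] {P : Measure Ω} {X : ι → Ω → ℝ}

/-- A Gaussian shift model with an independent Gaussian shift parameter is jointly Gaussian. -/
lemma isGaussianProcess_shift (hX : IsGaussianProcess X P) (v : ι → ℝ) (V : ℝ≥0) :
    IsGaussianProcess (fun o : Option ι => o.elim (fun q : ℝ × Ω => q.1)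
      (fun i (q : ℝ × Ω) => q.1 * v i + X i q.2)) ((gaussianReal 0 V).prod P) := by
  classical
  have := hX.isProbabilityMeasure
  refine ⟨fun J => ?_⟩
  set I : Finset ι := J.eraseNone with hI
  have h1 : HasGaussianLaw (fun q : ℝ × Ω => q.1) ((gaussianReal 0 V).prod P) := by
    refine ⟨?_⟩
    rw [show (fun q : ℝ × Ω => q.1) = Prod.fst from rfl, Measure.map_fst_prod]
    simp only [measure_univ, one_smul]
    infer_instance
  have hXI := hX.hasGaussianLaw I
  have h2 : HasGaussianLaw (fun q : ℝ × Ω => I.restrict (X · q.2)) ((gaussianReal 0 V).prod P) := by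
    refine ⟨?_⟩
    have e : (fun q : ℝ × Ω => I.restrict (X · q.2)) = (fun w => I.restrict (X · w)) ∘ Prod.snd := rfl
    rw [e, ← AEMeasurable.map_map_of_aemeasurable _ measurable_snd.aemeasurable,
      Measure.map_snd_prod]
    · simp only [measure_univ, one_smul]
      exact hXI.isGaussian_map
    · rw [Measure.map_snd_prod]
      simp only [measure_univ, one_smul]
      exact hXI.aemeasurable
  have hind : IndepFun (fun q : ℝ × Ω => q.1) (fun q : ℝ × Ω => I.restrict (X · q.2))
      ((gaussianReal 0 V).prod P) :=
    indepFun_prod₀ (X := id) (Y := fun w => I.restrict (X · w)) aemeasurable_id hXI.aemeasurable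
  have h3 := hind.hasGaussianLaw h1 h2
  let L : ℝ × (I → ℝ) →L[ℝ] (J → ℝ) := ContinuousLinearMap.pi fun o : J =>
    match o with
    | ⟨none, _⟩ => ContinuousLinearMap.fst ℝ ℝ (I → ℝ)
    | ⟨some i, h⟩ => v i • ContinuousLinearMap.fst ℝ ℝ (I → ℝ) +
        (ContinuousLinearMap.proj (R := ℝ) (φ := fun _ : I => ℝ)
          ⟨i, Finset.mem_eraseNone.2 h⟩).comp (ContinuousLinearMap.snd ℝ ℝ (I → ℝ))
  refine (h3.map_fun L).congr (ae_of_all _ fun q => ?_)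
  funext o
  obtain ⟨_ | i, ho⟩ := o
  · simp [L]
  · simp [L, mul_comm]

lemma integral_sub_sq_gaussianReal (m : ℝ) (V : ℝ≥0) :
    ∫ t, (t - m) ^ 2 ∂(gaussianReal m V) = V := by
  have h := variance_fun_id_gaussianReal (μ := m) (v := V)
  rw [variance_eq_integral (by fun_prop)] at h
  simpa using h

/-- **Bayes risk in a one-dimensional Gaussian shift model.** Let `X` be a centred Gaussian process
whose reproducing kernel Hilbert space contains the direction `v`, with squared norm at most `κ`.
Under a centred Gaussian prior of variance `V` on the amplitude `t`, no estimator of `t` from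
`t • v + X` has a Bayes risk below `(κ + V⁻¹)⁻¹`. -/
lemma le_bayesRisk_shift (hX : IsGaussianProcess X P) (hXm : ∀ i, Measurable (X i))
    (hX0 : ∀ i, P[X i] = 0) {v : ι → ℝ} {κ : ℝ} (hκ : 0 < κ)
    (hv : ∀ (I : Finset ι) (c : ι → ℝ),
      (∑ i ∈ I, c i * v i) ^ 2 ≤ κ * ∫ w, (∑ i ∈ I, c i * X i w) ^ 2 ∂P)
    {V : ℝ≥0} (hV : 0 < V) {T : (ι → ℝ) → ℝ} (hT : Measurable T) :
    ENNReal.ofReal ((κ + (V : ℝ)⁻¹)⁻¹) ≤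
      ∫⁻ t, ∫⁻ w, ENNReal.ofReal ((T (fun i => t * v i + X i w) - t) ^ 2) ∂P ∂(gaussianReal 0 V) := by
  classical
  have := hX.isProbabilityMeasure
  have hXL : ∀ i, MemLp (X i) 2 P := fun i => (hX.hasGaussianLaw_eval i).memLp_two
  have hθL : MemLp (fun t : ℝ => t) 2 (gaussianReal 0 V) := memLp_id_gaussianReal' 2 (by simp)
  have hθ2 : ∫ t : ℝ, t ^ 2 ∂(gaussianReal 0 V) = V := by
    simpa using integral_sub_sq_gaussianReal 0 V
  have hθ1 : ∫ t : ℝ, t ∂(gaussianReal 0 V) = 0 := integral_id_gaussianReal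
  have hm : Measurable fun q : ℝ × Ω =>
      ENNReal.ofReal ((T (fun i => q.1 * v i + X i q.2) - q.1) ^ 2) := by
    have : Measurable fun q : ℝ × Ω => T (fun i => q.1 * v i + X i q.2) :=
      hT.comp (measurable_pi_lambda _ fun i =>
        (measurable_fst.mul_const _).add ((hXm i).comp measurable_snd))
    fun_prop
  rw [← lintegral_prod (fun q : ℝ × Ω =>
      ENNReal.ofReal ((T (fun i => q.1 * v i + X i q.2) - q.1) ^ 2)) hm.aemeasurable]
  refine le_lintegral_sq_sub_of_linear (isGaussianProcess_shift hX v V)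
    (fun i => (measurable_fst.mul_const _).add ((hXm i).comp measurable_snd)) ?_ ?_ ?_ hT
  · rw [integral_fun_fst (f := fun t : ℝ => t), hθ1, smul_zero]
  · intro i
    have i1 : Integrable (fun q : ℝ × Ω => q.1 * v i) ((gaussianReal 0 V).prod P) :=
      ((hθL.integrable one_le_two).comp_fst P).mul_const (v i)
    have i2 : Integrable (fun q : ℝ × Ω => X i q.2) ((gaussianReal 0 V).prod P) :=
      ((hXL i).integrable one_le_two).comp_snd _
    rw [integral_add i1 i2, integral_mul_const, integral_fun_fst (f := fun t : ℝ => t), hθ1,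
      integral_fun_snd (f := X i), hX0]
    simp
  · intro I c
    set u := ∑ i ∈ I, c i * v i with hu
    set Z : Ω → ℝ := fun w => ∑ i ∈ I, c i * X i w with hZ
    have hZL : MemLp Z 2 P := memLp_finsetSum _ fun i _ => (hXL i).const_mul (c i)
    have hZ0 : P[Z] = 0 := by
      rw [hZ, integral_finsetSum _ fun i _ => ((hXL i).integrable one_le_two).const_mul (c i)]
      exact Finset.sum_eq_zero fun i _ => by rw [integral_const_mul, hX0, mul_zero]
    have e : ∀ q : ℝ × Ω, (q.1 - ∑ i ∈ I, c i * (q.1 * v i + X i q.2)) ^ 2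
        = (1 - u) ^ 2 * q.1 ^ 2 - 2 * (1 - u) * (q.1 * Z q.2) + Z q.2 ^ 2 := fun q => by
      have : ∑ i ∈ I, c i * (q.1 * v i + X i q.2) = q.1 * u + Z q.2 := by
        rw [hu, hZ, Finset.mul_sum, ← Finset.sum_add_distrib]
        exact Finset.sum_congr rfl fun i _ => by ring
      rw [this]; ring
    have hval : ∫ q : ℝ × Ω, (q.1 - ∑ i ∈ I, c i * (q.1 * v i + X i q.2)) ^ 2
        ∂((gaussianReal 0 V).prod P) = (1 - u) ^ 2 * V + ∫ w, Z w ^ 2 ∂P := by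
      simp only [e]
      have i1 : Integrable (fun q : ℝ × Ω => (1 - u) ^ 2 * q.1 ^ 2) ((gaussianReal 0 V).prod P) :=
        (hθL.integrable_sq.comp_fst P).const_mul _
      have i2 : Integrable (fun q : ℝ × Ω => 2 * (1 - u) * (q.1 * Z q.2))
          ((gaussianReal 0 V).prod P) :=
        ((hθL.integrable one_le_two).mul_prod (hZL.integrable one_le_two)).const_mul _
      have i3 : Integrable (fun q : ℝ × Ω => Z q.2 ^ 2) ((gaussianReal 0 V).prod P) :=
        hZL.integrable_sq.comp_snd _
      have e1 := integral_add (i1.sub i2) i3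
      simp only [Pi.sub_apply] at e1
      rw [e1, integral_sub i1 i2, integral_const_mul, integral_const_mul,
        integral_prod_mul (fun t : ℝ => t) Z, integral_fun_fst (f := fun t : ℝ => t ^ 2),
        integral_fun_snd (f := fun w => Z w ^ 2), hZ0, hθ2]
      simp
    have hVr : (0 : ℝ) < V := hV
    have hcs : u ^ 2 ≤ κ * ∫ w, Z w ^ 2 ∂P := hv I c
    change _ ≤ ∫ q : ℝ × Ω, (q.1 - ∑ i ∈ I, c i * (q.1 * v i + X i q.2)) ^ 2
        ∂((gaussianReal 0 V).prod P)
    rw [hval, inv_le_iff_one_le_mul₀ (by positivity)]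
    generalize ∫ w, Z w ^ 2 ∂P = E at hcs
    have hE : u ^ 2 / κ ≤ E := by rwa [div_le_iff₀' hκ]
    have key : ((1 - u) ^ 2 * V + u ^ 2 / κ) * (κ + (V : ℝ)⁻¹) - 1
        = (κ * V * (1 - u) - u) ^ 2 / (κ * V) := by
      field_simp; ring
    have : 0 ≤ (κ * V * (1 - u) - u) ^ 2 / (κ * V) := by positivity
    have h2 : ((1 - u) ^ 2 * V + u ^ 2 / κ) * (κ + (V : ℝ)⁻¹)
        ≤ ((1 - u) ^ 2 * V + E) * (κ + (V : ℝ)⁻¹) := by gcongr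
    linarith

lemma lintegral_pow_four_gaussianReal (V : ℝ≥0) :
    ∫⁻ t, ENNReal.ofReal (t ^ 4) ∂(gaussianReal 0 V)
      = ENNReal.ofReal (V ^ 2) * ∫⁻ t, ENNReal.ofReal (t ^ 4) ∂(gaussianReal 0 1) := by
  have h := gaussianReal_map_const_mul (μ := 0) (v := 1) (√(V : ℝ))
  have hV : NNReal.mk (√(V : ℝ) ^ 2) (sq_nonneg _) * 1 = V := by
    ext; simp
  rw [mul_zero, hV] at h
  rw [← h, lintegral_map (by fun_prop) (by fun_prop), ← lintegral_const_mul _ (by fun_prop)]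
  refine lintegral_congr fun t => ?_
  rw [← ENNReal.ofReal_mul (by positivity), mul_pow]
  congr 2
  rw [show (4 : ℕ) = 2 * 2 from rfl, pow_mul, Real.sq_sqrt (by positivity)]

lemma lintegral_pow_four_gaussianReal_ne_top :
    ∫⁻ t, ENNReal.ofReal (t ^ 4) ∂(gaussianReal 0 1) ≠ ∞ := by
  have h : MemLp (fun t : ℝ => t) (4 : ℝ≥0) (gaussianReal 0 1) := memLp_id_gaussianReal 4
  have h2 := h.integrable_norm_rpow (by simp) (by simp)
  have h3 : Integrable (fun t : ℝ => t ^ 4) (gaussianReal 0 1) := by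
    refine h2.congr (ae_of_all _ fun t => ?_)
    have : ((4 : ℝ≥0) : ℝ≥0∞).toReal = ((4 : ℕ) : ℝ) := by simp
    beta_reduce
    rw [this, Real.rpow_natCast, Real.norm_eq_abs]
    exact (by decide : Even 4).pow_abs t
  have h4 := h3.2
  rw [hasFiniteIntegral_iff_ofReal (ae_of_all _ fun t => by positivity)] at h4
  exact h4.ne

/-- **Minimax lower bound in a Gaussian shift model over a cube.** The prior is a product of centred
Gaussian laws of variance `V`; the mass that it leaves outside the cube `|x j| ≤ a` is paid for by
fourth moments, after the estimators have been truncated to `[-a, a]`. -/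
lemma card_mul_le_of_forall_cube_risk_le {J : Type*} [Fintype J] (hX : IsGaussianProcess X P)
    (hXm : ∀ i, Measurable (X i)) (hX0 : ∀ i, P[X i] = 0) {v : J → ι → ℝ} {κ : ℝ} (hκ : 0 < κ)
    (hv : ∀ (j : J) (I : Finset ι) (c : ι → ℝ),
      (∑ i ∈ I, c i * v j i) ^ 2 ≤ κ * ∫ w, (∑ i ∈ I, c i * X i w) ^ 2 ∂P)
    {V : ℝ≥0} (hV : 0 < V) {T : J → (ι → ℝ) → ℝ} (hT : ∀ j, Measurable (T j))
    {a : ℝ} (ha : 0 < a) {M : ℝ≥0∞}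
    (hM : ∀ x : J → ℝ, (∀ j, |x j| ≤ a) →
      ∑ l, ∫⁻ w, ENNReal.ofReal ((T l (fun i => ∑ j, x j * v j i + X i w) - x l) ^ 2) ∂P ≤ M) :
    Fintype.card J * ENNReal.ofReal ((κ + (V : ℝ)⁻¹)⁻¹) ≤
      M + Fintype.card J * (ENNReal.ofReal (4 / a ^ 2) * (Fintype.card J *
        ∫⁻ t, ENNReal.ofReal (t ^ 4) ∂(gaussianReal 0 V))) := by
  classical
  have := hX.isProbabilityMeasure
  set T' : J → (ι → ℝ) → ℝ := fun l y => max (-a) (min a (T l y)) with hT'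
  have hTm' : ∀ l, Measurable (T' l) := fun l =>
    measurable_const.max (measurable_const.min (hT l))
  set r : J → (J → ℝ) → ℝ≥0∞ := fun l x =>
    ∫⁻ w, ENNReal.ofReal ((T' l (fun i => ∑ j, x j * v j i + X i w) - x l) ^ 2) ∂P with hr
  have hrm : ∀ l, Measurable (r l) := fun l => by
    have h1 : Measurable fun q : (J → ℝ) × Ω => T' l (fun i => ∑ j, q.1 j * v j i + X i q.2) := by
      refine (hTm' l).comp (measurable_pi_lambda _ fun i => ?_)
      refine Measurable.add ?_ ((hXm i).comp measurable_snd)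
      exact Finset.measurable_fun_sum _ fun j _ =>
        ((measurable_pi_apply j).comp measurable_fst).mul_const _
    have h2 : Measurable fun q : (J → ℝ) × Ω => q.1 l := (measurable_pi_apply l).comp measurable_fst
    exact Measurable.lintegral_prod_right' (f := fun q : (J → ℝ) × Ω =>
      ENNReal.ofReal ((T' l (fun i => ∑ j, q.1 j * v j i + X i q.2) - q.1 l) ^ 2))
      ((h1.sub h2).pow_const 2).ennreal_ofReal
  have hTa : ∀ l y, |T' l y| ≤ a := fun l y =>
    abs_le.2 ⟨le_max_left _ _, max_le (by linarith) (min_le_left _ _)⟩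
  set π : Measure (J → ℝ) := Measure.pi fun _ => gaussianReal 0 V with hπ
  -- freezing the other coordinates gives a one-dimensional shift model
  have hlow : ∀ l, ENNReal.ofReal ((κ + (V : ℝ)⁻¹)⁻¹) ≤ ∫⁻ x, r l x ∂π := fun l => by
    have h1 := lintegral_le_of_lmarginal_le (μ := fun _ : J => gaussianReal 0 V) {l}
      (f := fun _ => ENNReal.ofReal ((κ + (V : ℝ)⁻¹)⁻¹)) (g := r l) measurable_const (hrm l) ?_
    · simpa using h1
    · intro x
      simp only [lmarginal_singleton, lintegral_const, measure_univ, mul_one]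
      set y : ι → ℝ := fun i => ∑ j ∈ Finset.univ.erase l, x j * v j i
      have hTy : Measurable fun z : ι → ℝ => T' l (fun i => z i + y i) :=
        (hTm' l).comp (measurable_pi_lambda _ fun i => (measurable_pi_apply i).add_const _)
      refine (le_bayesRisk_shift hX hXm hX0 hκ (hv l) hV hTy).trans (le_of_eq ?_)
      refine lintegral_congr fun t => ?_
      simp only [hr]
      refine lintegral_congr fun w => ?_
      rw [Function.update_self]
      congr 4
      ext i
      rw [← Finset.add_sum_erase _ _ (Finset.mem_univ l), Function.update_self]
      have : ∑ j ∈ Finset.univ.erase l, Function.update x l t j * v j i = y i :=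
        Finset.sum_congr rfl fun j hj => by rw [Function.update_of_ne (Finset.ne_of_mem_erase hj)]
      rw [this]; ring
  have hup : ∀ x, ∑ l, r l x ≤ M + ∑ _l : J, ENNReal.ofReal (4 / a ^ 2) *
      ∑ j, ENNReal.ofReal (x j ^ 4) := fun x => by
    by_cases hx : ∀ j, |x j| ≤ a
    · refine le_trans (le_trans (Finset.sum_le_sum fun l _ => ?_) (hM x hx)) le_self_add
      refine lintegral_mono fun w => ENNReal.ofReal_le_ofReal ?_
      -- truncation to an interval that contains the parameter decreases the loss
      simp only [hT']
      generalize T l (fun i => ∑ j, x j * v j i + X i w) = τ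
      obtain ⟨h1, h2⟩ := abs_le.1 (hx l)
      rw [sq_le_sq]
      rcases le_total a τ with h | h
      · rw [min_eq_left h, max_eq_right (by linarith), abs_of_nonneg (by linarith),
          abs_of_nonneg (by linarith)]
        linarith
      · rw [min_eq_right h]
        rcases le_total (-a) τ with h' | h'
        · rw [max_eq_right h']
        · rw [max_eq_left h', abs_of_nonpos (by linarith), abs_of_nonpos (by linarith)]
          linarith
    · push Not at hx
      obtain ⟨k, hk⟩ := hx
      refine le_trans (Finset.sum_le_sum fun l _ => ?_) le_add_self
      rw [← ENNReal.ofReal_sum_of_nonneg fun j _ => by positivity,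
        ← ENNReal.ofReal_mul (by positivity)]
      calc r l x ≤ ∫⁻ _w, ENNReal.ofReal (4 / a ^ 2 * ∑ j, x j ^ 4) ∂P := by
            refine lintegral_mono fun w => ENNReal.ofReal_le_ofReal ?_
            have h1 := hTa l (fun i => ∑ j, x j * v j i + X i w)
            generalize T' l (fun i => ∑ j, x j * v j i + X i w) = τ at *
            have hτ : τ ^ 2 ≤ a ^ 2 := sq_le_sq' (abs_le.1 h1).1 (abs_le.1 h1).2
            have hk4 : a ^ 4 ≤ x k ^ 4 := by
              rw [← (by decide : Even 4).pow_abs (x k)]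
              exact pow_le_pow_left₀ ha.le hk.le 4
            have s1 : x k ^ 4 ≤ ∑ j, x j ^ 4 :=
              Finset.single_le_sum (f := fun j => x j ^ 4) (fun j _ => by positivity)
                (Finset.mem_univ k)
            have s2 : x l ^ 4 ≤ ∑ j, x j ^ 4 :=
              Finset.single_le_sum (f := fun j => x j ^ 4) (fun j _ => by positivity)
                (Finset.mem_univ l)
            rw [div_mul_eq_mul_div, le_div_iff₀ (by positivity)]
            have e1 : (τ - x l) ^ 2 ≤ 2 * a ^ 2 + 2 * x l ^ 2 := by
              nlinarith [sq_nonneg (τ + x l)]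
            nlinarith [sq_nonneg (a ^ 2 - x l ^ 2), mul_le_mul_of_nonneg_right e1 (sq_nonneg a)]
        _ = _ := by simp
  calc Fintype.card J * ENNReal.ofReal ((κ + (V : ℝ)⁻¹)⁻¹)
      = ∑ _l : J, ENNReal.ofReal ((κ + (V : ℝ)⁻¹)⁻¹) := by simp
    _ ≤ ∑ l, ∫⁻ x, r l x ∂π := Finset.sum_le_sum fun l _ => hlow l
    _ = ∫⁻ x, ∑ l, r l x ∂π := (lintegral_finsetSum _ fun l _ => hrm l).symm
    _ ≤ ∫⁻ x, (M + ∑ _l : J, ENNReal.ofReal (4 / a ^ 2) * ∑ j, ENNReal.ofReal (x j ^ 4)) ∂π :=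
        lintegral_mono hup
    _ = _ := by
        have hj : ∀ j : J, ∫⁻ x : J → ℝ, ENNReal.ofReal (x j ^ 4) ∂π
            = ∫⁻ t, ENNReal.ofReal (t ^ 4) ∂(gaussianReal 0 V) := fun j =>
          (measurePreserving_eval (fun _ : J => gaussianReal 0 V) j).lintegral_comp
            (f := fun t => ENNReal.ofReal (t ^ 4)) (by fun_prop)
        have hmj : ∀ j : J, Measurable fun x : J → ℝ => ENNReal.ofReal (x j ^ 4) := fun j => by
          fun_prop
        rw [lintegral_add_left measurable_const, lintegral_const, measure_univ, mul_one]
        simp only [Finset.sum_const, Finset.card_univ, nsmul_eq_mul]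
        rw [lintegral_const_mul _ (by fun_prop), lintegral_const_mul _ (by fun_prop),
          lintegral_finsetSum _ fun j _ => hmj j]
        simp [hj]

end Shift

/-! ### The ellipsoid of coefficients -/

section Ellipsoid

lemma freq_mono : Monotone freq := fun a b h => by unfold freq; omega

lemma weight_pos (ω : ℝ) (l : ℕ) : 0 < weight ω l := Real.exp_pos _

lemma weight_mono (ω : ℝ) : Monotone (weight ω) := fun a b h => by
  unfold weight
  have : (freq a : ℝ) ≤ freq b := by exact_mod_cast freq_mono h
  gcongr

/-- The half-width of an `N`-dimensional cube of coefficients contained in the ellipsoid. -/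
def cubeRadius (ω Q : ℝ) (N : ℕ) : ℝ := √(Q / (N * weight ω N))

/-- A vector of the first `N` coefficients, extended by zero. -/
def extendZero {N : ℕ} (x : Fin N → ℝ) (l : ℕ) : ℝ := if h : l < N then x ⟨l, h⟩ else 0

lemma extendZero_coe {N : ℕ} (x : Fin N → ℝ) (j : Fin N) : extendZero x j = x j := by
  simp [extendZero]

lemma extendZero_of_le {N : ℕ} (x : Fin N → ℝ) {l : ℕ} (h : N ≤ l) : extendZero x l = 0 := by
  simp [extendZero, h.not_gt]

lemma extendZero_mem_coefEllipsoid {ω Q : ℝ} (hQ : 0 < Q) {N : ℕ} {x : Fin N → ℝ}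
    (hx : ∀ j, |x j| ≤ cubeRadius ω Q N) : extendZero x ∈ coefEllipsoid ω Q := by
  have h0 : ∀ l ∉ Finset.range N, weight ω l * extendZero x l ^ 2 = 0 := fun l hl => by
    rw [extendZero_of_le x (by simpa using hl)]; simp
  have hs : HasSum (fun l => weight ω l * extendZero x l ^ 2)
      (∑ l ∈ Finset.range N, weight ω l * extendZero x l ^ 2) := hasSum_sum_of_ne_finset_zero h0
  refine ⟨hs.summable, ?_⟩
  rw [hs.tsum_eq, Finset.sum_range]
  rcases N.eq_zero_or_pos with rfl | hN
  · simpa using hQ.le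
  have hN' : (0 : ℝ) < N := by exact_mod_cast hN
  have hw := weight_pos ω N
  calc ∑ i : Fin N, weight ω i * extendZero x i ^ 2
      ≤ ∑ _i : Fin N, weight ω N * (Q / (N * weight ω N)) := by
        refine Finset.sum_le_sum fun i _ => ?_
        rw [extendZero_coe]
        refine mul_le_mul (weight_mono ω i.2.le) ?_ (sq_nonneg _) hw.le
        have h1 : 0 ≤ Q / (N * weight ω N) := by positivity
        rw [← Real.sq_sqrt h1]
        exact sq_le_sq' (abs_le.1 (hx i)).1 (abs_le.1 (hx i)).2
    _ = Q := by
        simp only [Finset.sum_const, Finset.card_univ, Fintype.card_fin, nsmul_eq_mul]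
        field_simp

/-- The risk of an estimator that has risk at most `e` in each of the first `N` coordinates and
vanishes in the others. -/
lemma tsum_risk_le {ω Q : ℝ} {N : ℕ} {θ : ℕ → ℝ} (hθ : θ ∈ coefEllipsoid ω Q) {e : ℝ≥0∞}
    {u : ℕ → ℝ≥0∞} (h1 : ∀ l < N, u l ≤ e) (h2 : ∀ l, N ≤ l → u l ≤ ENNReal.ofReal (θ l ^ 2)) :
    ∑' l, u l ≤ N * e + ENNReal.ofReal (Q / weight ω N) := by
  have hw := weight_pos ω N
  have hle : ∀ l, u l ≤ (if l ∈ Finset.range N then e else 0)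
      + ENNReal.ofReal (weight ω l * θ l ^ 2 / weight ω N) := fun l => by
    by_cases hl : l < N
    · simp only [Finset.mem_range, hl, if_true]
      exact (h1 l hl).trans le_self_add
    · refine (h2 l (not_lt.1 hl)).trans (le_trans (ENNReal.ofReal_le_ofReal ?_) le_add_self)
      rw [le_div_iff₀ hw, mul_comm]
      exact mul_le_mul_of_nonneg_right (weight_mono ω (not_lt.1 hl)) (sq_nonneg _)
  refine (ENNReal.tsum_le_tsum hle).trans ?_
  rw [ENNReal.tsum_add]
  refine add_le_add (le_of_eq ?_) ?_
  · rw [tsum_eq_sum (s := Finset.range N) fun l hl => by rw [if_neg hl],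
      Finset.sum_congr rfl fun l hl => if_pos hl]
    simp
  · rw [← ENNReal.ofReal_tsum_of_nonneg
      (fun l => div_nonneg (mul_nonneg (weight_pos ω l).le (sq_nonneg _)) hw.le)
      (hθ.1.div_const _), tsum_div_const]
    exact ENNReal.ofReal_le_ofReal (div_le_div_of_nonneg_right hθ.2 hw.le)

end Ellipsoid

/-! ### The lower bound common to both models -/

section Model

variable {Ω ι : Type*} [MeasurableSpace Ω] {P : Measure Ω}

lemma integral_sum_mul_sq {K : Type*} {X : K → Ω → ℝ} (hX : ∀ k, MemLp (X k) 2 P) (I : Finset K)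
    (c : K → ℝ) :
    ∫ w, (∑ k ∈ I, c k * X k w) ^ 2 ∂P
      = ∑ k ∈ I, ∑ l ∈ I, c k * c l * ∫ w, X k w * X l w ∂P := by
  have hi : ∀ k l, Integrable (fun w => c k * X k w * (c l * X l w)) P := fun k l =>
    ((hX k).const_mul (c k)).integrable_mul ((hX l).const_mul (c l))
  simp only [sq, Finset.sum_mul_sum]
  rw [integral_finsetSum _ fun k _ => integrable_finsetSum _ fun l _ => hi k l]
  refine Finset.sum_congr rfl fun k _ => ?_
  rw [integral_finsetSum _ fun l _ => hi k l]
  refine Finset.sum_congr rfl fun l _ => ?_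
  rw [← integral_const_mul]
  exact integral_congr_ae (ae_of_all _ fun w => by ring)

/-- The lower bound that both models share, for noise of level `n⁻¹` and a prior of variance
`L / n`. -/
lemma minimax_lower_bound {X : ι → Ω → ℝ} (hX : IsGaussianProcess X P)
    (hXm : ∀ i, Measurable (X i)) (hX0 : ∀ i, P[X i] = 0) {n N : ℕ} (hn : 0 < n) (hN : 0 < N)
    {v : Fin N → ι → ℝ}
    (hv : ∀ (j : Fin N) (I : Finset ι) (c : ι → ℝ),
      (∑ i ∈ I, c i * v j i) ^ 2 ≤ n * ∫ w, (∑ i ∈ I, c i * X i w) ^ 2 ∂P)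
    {T : (ι → ℝ) → ℕ → ℝ} (hT : Measurable T) {ω Q L : ℝ} (hQ : 0 < Q) (hL : 0 < L) {M : ℝ≥0∞}
    (hM : ∀ x : Fin N → ℝ, extendZero x ∈ coefEllipsoid ω Q →
      ∑' l, ∫⁻ w, ENNReal.ofReal
        ((T (fun i => ∑ j, x j * v j i + X i w) l - extendZero x l) ^ 2) ∂P ≤ M) :
    ENNReal.ofReal (N * (n * (1 + L⁻¹))⁻¹) ≤ M + ENNReal.ofReal
      (4 * (∫⁻ t, ENNReal.ofReal (t ^ 4) ∂(gaussianReal 0 1)).toReal * N ^ 3 * weight ω N * L ^ 2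
        / (n ^ 2 * Q)) := by
  have hn' : (0 : ℝ) < n := by exact_mod_cast hn
  have hN' : (0 : ℝ) < N := by exact_mod_cast hN
  have hw := weight_pos ω N
  set V : ℝ≥0 := ⟨L / n, by positivity⟩ with hVdef
  have hV : 0 < V := by
    rw [← NNReal.coe_pos]; exact div_pos hL hn'
  have hVr : (V : ℝ) = L / n := rfl
  have ha : 0 < cubeRadius ω Q N := Real.sqrt_pos.2 (by positivity)
  have ha2 : cubeRadius ω Q N ^ 2 = Q / (N * weight ω N) := Real.sq_sqrt (by positivity)
  have h := card_mul_le_of_forall_cube_risk_le hX hXm hX0 hn' hv hV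
    (T := fun j y => T y j) (fun j => (measurable_pi_apply _).comp hT) ha (M := M) fun x hx => by
      refine le_trans ?_ (hM x (extendZero_mem_coefEllipsoid hQ hx))
      refine le_trans (le_of_eq ?_) (ENNReal.sum_le_tsum (Finset.range N))
      rw [Finset.sum_range]
      simp only [extendZero_coe]
  rw [lintegral_pow_four_gaussianReal, ← ENNReal.ofReal_toReal lintegral_pow_four_gaussianReal_ne_top,
    Fintype.card_fin, ← ENNReal.ofReal_natCast, ha2, hVr] at h
  rw [← ENNReal.ofReal_mul (by positivity), ← ENNReal.ofReal_mul (by positivity),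
    ← ENNReal.ofReal_mul (by positivity), ← ENNReal.ofReal_mul (by positivity),
    ← ENNReal.ofReal_mul (by positivity)] at h
  convert h using 2
  · congr 2
    field_simp
  · congr 1
    field_simp

end Model

/-! ### The Gaussian sequence model -/

section SequenceModel

lemma sequenceLaw_eq_map (n : ℕ) (θ : ℕ → ℝ) :
    sequenceLaw n θ = (sequenceLaw n 0).map (fun y i => θ i + y i) := by
  unfold sequenceLaw
  rw [Measure.infinitePi_map_pi (f := fun i y => θ i + y) _ (fun i => by fun_prop)]
  simp [gaussianReal_map_const_add]

instance (n : ℕ) (θ : ℕ → ℝ) : IsProbabilityMeasure (sequenceLaw n θ) := by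
  unfold sequenceLaw; infer_instance

lemma measurePreserving_eval_sequenceLaw (n : ℕ) (θ : ℕ → ℝ) (l : ℕ) :
    MeasurePreserving (fun y : ℕ → ℝ => y l) (sequenceLaw n θ)
      (gaussianReal (θ l) ((n : ℝ≥0)⁻¹)) :=
  measurePreserving_eval_infinitePi (fun l => gaussianReal (θ l) ((n : ℝ≥0)⁻¹)) l

lemma isGaussianProcess_sequence (n : ℕ) :
    IsGaussianProcess (fun (i : ℕ) (y : ℕ → ℝ) => y i) (sequenceLaw n 0) := by
  have hind : iIndepFun (fun (i : ℕ) (y : ℕ → ℝ) => y i) (sequenceLaw n 0) :=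
    iIndepFun_infinitePi (X := fun _ y => y) fun _ => measurable_id
  refine ⟨fun I => ?_⟩
  refine iIndepFun.hasGaussianLaw (X := fun (i : I) (y : ℕ → ℝ) => y i) (fun i => ⟨?_⟩)
    (hind.precomp Subtype.val_injective)
  rw [(measurePreserving_eval_sequenceLaw n 0 i).map_eq]
  infer_instance

lemma integral_sequenceLaw_eval (n i : ℕ) {f : ℝ → ℝ} (hf : Continuous f) :
    ∫ y, f (y i) ∂(sequenceLaw n 0) = ∫ t, f t ∂(gaussianReal 0 ((n : ℝ≥0)⁻¹)) := by
  have h := measurePreserving_eval_sequenceLaw n 0 i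
  rw [Pi.zero_apply] at h
  rw [← h.map_eq, integral_map h.measurable.aemeasurable hf.aestronglyMeasurable]

lemma integral_sequenceLaw (n i : ℕ) : ∫ y, y i ∂(sequenceLaw n 0) = 0 := by
  rw [integral_sequenceLaw_eval n i continuous_id']
  exact integral_id_gaussianReal

lemma integral_sequenceLaw_mul (n i j : ℕ) :
    ∫ y, y i * y j ∂(sequenceLaw n 0) = if i = j then (n : ℝ)⁻¹ else 0 := by
  have hL : ∀ i, MemLp (fun y : ℕ → ℝ => y i) 2 (sequenceLaw n 0) := fun i =>
    ((isGaussianProcess_sequence n).hasGaussianLaw_eval i).memLp_two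
  by_cases hij : i = j
  · subst hij
    rw [if_pos rfl, integral_sequenceLaw_eval n i (f := fun t => t * t) (by fun_prop)]
    simpa [sq] using integral_sub_sq_gaussianReal 0 ((n : ℝ≥0)⁻¹)
  · have hind : iIndepFun (fun (i : ℕ) (y : ℕ → ℝ) => y i) (sequenceLaw n 0) :=
      iIndepFun_infinitePi (X := fun _ y => y) fun _ => measurable_id
    rw [if_neg hij, (hind.indepFun hij).integral_fun_mul_eq_mul_integral
      (hL i).aestronglyMeasurable (hL j).aestronglyMeasurable, integral_sequenceLaw, zero_mul]

lemma sequenceMinimaxRisk_lower {ω Q L : ℝ} (hQ : 0 < Q) (hL : 0 < L) {n N : ℕ} (hn : 0 < n)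
    (hN : 0 < N) :
    ENNReal.ofReal (N * (n * (1 + L⁻¹))⁻¹) ≤ sequenceMinimaxRisk ω Q n + ENNReal.ofReal
      (4 * (∫⁻ t, ENNReal.ofReal (t ^ 4) ∂(gaussianReal 0 1)).toReal * N ^ 3 * weight ω N * L ^ 2
        / (n ^ 2 * Q)) := by
  have hn' : (0 : ℝ) < n := by exact_mod_cast hn
  rw [← tsub_le_iff_right]
  refine le_iInf₂ fun T hT => ?_
  rw [tsub_le_iff_right]
  refine minimax_lower_bound (isGaussianProcess_sequence n) (fun i => measurable_pi_apply i)
    (integral_sequenceLaw n) hn hN (v := fun j i => if (j : ℕ) = i then 1 else 0) ?_ hT hQ hL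
    fun x hx => ?_
  · intro j I c
    rw [integral_sum_mul_sq
      (fun i => ((isGaussianProcess_sequence n).hasGaussianLaw_eval i).memLp_two)]
    simp only [integral_sequenceLaw_mul, mul_ite, mul_one, mul_zero, Finset.sum_ite_eq]
    rw [Finset.sum_congr rfl fun k hk => if_pos hk, Finset.mul_sum]
    have e : ∀ k, (n : ℝ) * (c k * c k * (n : ℝ)⁻¹) = c k ^ 2 := fun k => by field_simp
    simp only [e]
    split_ifs with hj
    · exact Finset.single_le_sum (f := fun k => c k ^ 2) (fun k _ => sq_nonneg _) hj
    · rw [zero_pow two_ne_zero]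
      exact Finset.sum_nonneg fun k _ => sq_nonneg _
  · refine le_trans (le_of_eq ?_) (le_iSup₂ (f := fun θ _ => sequenceRisk n T θ) (extendZero x) hx)
    unfold sequenceRisk
    refine tsum_congr fun l => ?_
    rw [sequenceLaw_eq_map n (extendZero x), lintegral_map]
    · refine lintegral_congr fun y => ?_
      congr 4
      ext i
      congr 1
      by_cases hi : i < N
      · rw [Finset.sum_eq_single (⟨i, hi⟩ : Fin N)]
        · simp [extendZero, hi]
        · intro j _ hj
          rw [if_neg (fun h => hj (Fin.ext h)), mul_zero]
        · simp
      · rw [extendZero_of_le x (not_lt.1 hi)]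
        refine Finset.sum_eq_zero fun j _ => ?_
        rw [if_neg (fun h : (j : ℕ) = i => hi (h ▸ j.2)), mul_zero]
    · have : Measurable fun y : ℕ → ℝ => T y l := (measurable_pi_apply l).comp hT
      fun_prop
    · fun_prop

lemma sequenceMinimaxRisk_upper (ω Q : ℝ) {n : ℕ} (hn : 0 < n) (N : ℕ) :
    sequenceMinimaxRisk ω Q n ≤ ENNReal.ofReal (N / n + Q / weight ω N) := by
  have hT : Measurable fun (y : ℕ → ℝ) (l : ℕ) => if l < N then y l else 0 := by
    refine measurable_pi_lambda _ fun l => ?_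
    split_ifs
    · exact measurable_pi_apply l
    · exact measurable_const
  refine iInf₂_le_of_le _ hT (iSup₂_le fun θ hθ => ?_)
  refine (tsum_risk_le hθ (N := N) (e := ENNReal.ofReal (n : ℝ)⁻¹) (fun l hl => ?_)
    fun l hl => ?_).trans (le_of_eq ?_)
  · simp only [hl, if_true]
    rw [(measurePreserving_eval_sequenceLaw n θ l).lintegral_comp
      (f := fun t => ENNReal.ofReal ((t - θ l) ^ 2)) (by fun_prop),
      ← ofReal_integral_eq_lintegral_ofReal _ (ae_of_all _ fun t => sq_nonneg _),
      integral_sub_sq_gaussianReal]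
    · simp
    · exact ((memLp_id_gaussianReal' 2 (by simp)).sub (memLp_const (θ l))).integrable_sq
  · simp [not_lt.2 hl]
  · have hQ' : 0 ≤ Q := (tsum_nonneg fun l =>
      mul_nonneg (weight_pos ω l).le (sq_nonneg (θ l))).trans hθ.2
    rw [← ENNReal.ofReal_natCast, ← ENNReal.ofReal_mul (by positivity),
      ← ENNReal.ofReal_add (by positivity) (div_nonneg hQ' (weight_pos ω N).le),
      div_eq_mul_inv _ (n : ℝ)]

end SequenceModel

/-! ### The trigonometric basis -/

section TrigBasis

open Real intervalIntegral

lemma continuous_trigBasis (l : ℕ) : Continuous (trigBasis l) := by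
  unfold trigBasis
  split_ifs <;> fun_prop

lemma abs_trigBasis_le_one (l : ℕ) (t : ℝ) : |trigBasis l t| ≤ 1 := by
  have h1 : (√π)⁻¹ ≤ 1 := inv_le_one_of_one_le₀ (Real.one_le_sqrt.2 (by linarith [pi_gt_three]))
  have h2 : (√(2 * π))⁻¹ ≤ 1 :=
    inv_le_one_of_one_le₀ (Real.one_le_sqrt.2 (by linarith [pi_gt_three]))
  unfold trigBasis
  split_ifs
  · rwa [abs_of_nonneg (by positivity)]
  · rw [abs_mul, abs_of_nonneg (by positivity : 0 ≤ (√π)⁻¹)]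
    exact mul_le_one₀ h1 (abs_nonneg _) (abs_sin_le_one _)
  · rw [abs_mul, abs_of_nonneg (by positivity : 0 ≤ (√π)⁻¹)]
    exact mul_le_one₀ h1 (abs_nonneg _) (abs_cos_le_one _)

lemma integral_cos_int_mul (m : ℤ) :
    ∫ t in (-π)..π, cos (m * t) = if m = 0 then 2 * π else 0 := by
  split_ifs with hm
  · simp [hm]; ring
  · have hm' : (m : ℝ) ≠ 0 := by exact_mod_cast hm
    rw [integral_comp_mul_left (fun x => cos x) hm', integral_cos]
    simp [sin_int_mul_pi]

lemma integral_sin_mul (a : ℝ) : ∫ t in (-π)..π, sin (a * t) = 0 := by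
  have h := integral_comp_neg (a := -π) (b := π) (fun t => sin (a * t))
  simp only [mul_neg, sin_neg, neg_neg, intervalIntegral.integral_neg] at h
  linarith

lemma integral_cos_mul_cos (p q : ℕ) :
    ∫ t in (-π)..π, cos (p * t) * cos (q * t)
      = ((if p = q then 2 * π else 0) + (if p = 0 ∧ q = 0 then 2 * π else 0)) / 2 := by
  have e : ∀ t : ℝ, cos (p * t) * cos (q * t)
      = (cos (((p - q : ℤ) : ℝ) * t) + cos (((p + q : ℤ) : ℝ) * t)) / 2 := fun t => by
    push_cast
    rw [sub_mul, add_mul, cos_sub, cos_add]; ring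
  simp only [e]
  rw [intervalIntegral.integral_div, intervalIntegral.integral_add
    (by apply Continuous.intervalIntegrable; fun_prop)
    (by apply Continuous.intervalIntegrable; fun_prop), integral_cos_int_mul, integral_cos_int_mul]
  congr 3
  · simp only [eq_iff_iff]; omega
  · simp only [eq_iff_iff]; omega

lemma integral_sin_mul_sin (p q : ℕ) (hp : 0 < p) :
    ∫ t in (-π)..π, sin (p * t) * sin (q * t) = if p = q then π else 0 := by
  have e : ∀ t : ℝ, sin (p * t) * sin (q * t)
      = (cos (((p - q : ℤ) : ℝ) * t) - cos (((p + q : ℤ) : ℝ) * t)) / 2 := fun t => by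
    push_cast
    rw [sub_mul, add_mul, cos_sub, cos_add]; ring
  simp only [e]
  rw [intervalIntegral.integral_div, intervalIntegral.integral_sub
    (by apply Continuous.intervalIntegrable; fun_prop)
    (by apply Continuous.intervalIntegrable; fun_prop), integral_cos_int_mul, integral_cos_int_mul,
    if_neg (by omega : ¬ ((p : ℤ) + q = 0))]
  split_ifs with h1 h2 h2
  · ring
  · omega
  · omega
  · ring

lemma integral_sin_mul_cos (p q : ℕ) :
    ∫ t in (-π)..π, sin (p * t) * cos (q * t) = 0 := by
  have e : ∀ t : ℝ, sin (p * t) * cos (q * t)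
      = (sin ((p + q : ℝ) * t) + sin ((p - q : ℝ) * t)) / 2 := fun t => by
    rw [sub_mul, add_mul, sin_sub, sin_add]; ring
  simp only [e]
  rw [intervalIntegral.integral_div, intervalIntegral.integral_add
    (by apply Continuous.intervalIntegrable; fun_prop)
    (by apply Continuous.intervalIntegrable; fun_prop), integral_sin_mul, integral_sin_mul]
  simp

lemma trigBasis_of_odd {l : ℕ} (h : Odd l) :
    trigBasis l = fun t => (√π)⁻¹ * sin (freq l * t) := by
  ext t
  rw [trigBasis, if_neg h.pos.ne', if_pos h]

/-- The constant `φ_0` is treated as a cosine of frequency `0`. -/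
lemma trigBasis_of_even {l : ℕ} (h : Even l) :
    trigBasis l = fun t => (if l = 0 then (√(2 * π))⁻¹ else (√π)⁻¹) * cos (freq l * t) := by
  ext t
  rw [trigBasis, if_neg (Nat.not_odd_iff_even.2 h)]
  split_ifs with h0
  · simp [h0, freq]
  · rfl

/-- Orthonormality of the trigonometric basis in `L²(-π, π)`. -/
lemma integral_trigBasis_mul (k l : ℕ) :
    ∫ t in (-π)..π, trigBasis k t * trigBasis l t = if k = l then 1 else 0 := by
  have hπ : (√π)⁻¹ * (√π)⁻¹ = π⁻¹ := by
    rw [← mul_inv, Real.mul_self_sqrt pi_pos.le]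
  have h2π : (√(2 * π))⁻¹ * (√(2 * π))⁻¹ = (2 * π)⁻¹ := by
    rw [← mul_inv, Real.mul_self_sqrt (by positivity)]
  have hfac : ∀ (a c : ℝ) (f g : ℝ → ℝ), ∫ t in (-π)..π, a * f t * (c * g t)
      = a * c * ∫ t in (-π)..π, f t * g t := fun a c f g => by
    rw [← intervalIntegral.integral_const_mul]
    exact intervalIntegral.integral_congr fun t _ => by ring
  have hpi := pi_pos.ne'
  rcases Nat.even_or_odd k with hk | hk <;> rcases Nat.even_or_odd l with hl | hl
  · rw [trigBasis_of_even hk, trigBasis_of_even hl]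
    refine (hfac _ _ (fun t => cos (freq k * t)) (fun t => cos (freq l * t))).trans ?_
    rw [integral_cos_mul_cos]
    have e1 : freq k = freq l ↔ k = l := by
      unfold freq; obtain ⟨r, rfl⟩ := hk; obtain ⟨s, rfl⟩ := hl; omega
    have e2 : (freq k = 0 ∧ freq l = 0) ↔ k = 0 ∧ l = 0 := by
      unfold freq; obtain ⟨r, rfl⟩ := hk; obtain ⟨s, rfl⟩ := hl; omega
    simp only [e1, e2]
    by_cases hkl : k = l
    · subst hkl
      by_cases h0 : k = 0
      · simp only [h0, if_true, and_self, h2π]; field_simp; ring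
      · simp only [h0, if_true, if_false, and_self, hπ]; field_simp; ring
    · rw [if_neg hkl, if_neg (by omega : ¬ (k = 0 ∧ l = 0))]; simp [hkl]
  · have hkl : k ≠ l := by rintro rfl; exact Nat.not_odd_iff_even.2 hk hl
    rw [trigBasis_of_even hk, trigBasis_of_odd hl, if_neg hkl]
    refine (hfac _ _ (fun t => cos (freq k * t)) (fun t => sin (freq l * t))).trans ?_
    simp only [mul_comm (cos _), integral_sin_mul_cos, mul_zero]
  · have hkl : k ≠ l := by rintro rfl; exact Nat.not_odd_iff_even.2 hl hk
    rw [trigBasis_of_odd hk, trigBasis_of_even hl, if_neg hkl]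
    refine (hfac _ _ (fun t => sin (freq k * t)) (fun t => cos (freq l * t))).trans ?_
    rw [integral_sin_mul_cos, mul_zero]
  · rw [trigBasis_of_odd hk, trigBasis_of_odd hl]
    have e1 : freq k = freq l ↔ k = l := by
      unfold freq; obtain ⟨r, rfl⟩ := hk; obtain ⟨s, rfl⟩ := hl; omega
    have e0 : 0 < freq k := by unfold freq; obtain ⟨r, rfl⟩ := hk; omega
    refine (hfac _ _ (fun t => sin (freq k * t)) (fun t => sin (freq l * t))).trans ?_
    simp only [integral_sin_mul_sin _ _ e0, hπ, e1]
    split_ifs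
    · field_simp
    · simp

end TrigBasis

/-! ### The ellipsoid of functions -/

section Ellipsoid

lemma summable_inv_weight {ω : ℝ} (hω : 0 < ω) : Summable fun l => (weight ω l)⁻¹ := by
  -- geometric majorant: `l ≤ 4 (freq l)² + 1`, hence `(weight ω l)⁻¹ ≤ exp ((1 - l) ω² / 8)`
  have hg : Summable fun l : ℕ => Real.exp (ω ^ 2 / 8) * Real.exp (-(ω ^ 2 / 8)) ^ l :=
    (summable_geometric_of_lt_one (Real.exp_pos _).le (Real.exp_lt_one_iff.2 (by
      have : 0 < ω ^ 2 / 8 := by positivity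
      linarith))).mul_left _
  refine Summable.of_nonneg_of_le (fun l => (inv_pos.2 (weight_pos ω l)).le) (fun l => ?_) hg
  rw [weight, ← Real.exp_neg, ← Real.exp_nat_mul, ← Real.exp_add]
  apply Real.exp_le_exp.2
  have h1 : (l : ℝ) ≤ 2 * freq l := by
    have : l ≤ 2 * freq l := by unfold freq; omega
    exact_mod_cast this
  have h2 : (0 : ℝ) < ω ^ 2 := by positivity
  have h3 : (l : ℝ) ≤ 4 * (freq l : ℝ) ^ 2 + 1 := by nlinarith [sq_nonneg (2 * (freq l : ℝ) - 1)]
  nlinarith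

/-- A bound for the absolutely convergent series `∑ |θ_l|`, uniform over the ellipsoid. -/
lemma summable_abs_coef {ω Q : ℝ} (hω : 0 < ω) {θ : ℕ → ℝ} (hθ : θ ∈ coefEllipsoid ω Q) :
    Summable (fun l => |θ l|) ∧ ∑' l, |θ l| ≤ Q + ∑' l, (weight ω l)⁻¹ := by
  have hs := summable_inv_weight hω
  have hle : ∀ l, |θ l| ≤ weight ω l * θ l ^ 2 + (weight ω l)⁻¹ := fun l => by
    have hw := weight_pos ω l
    rw [← sq_abs (θ l)]
    have h : weight ω l * |θ l| ^ 2 + (weight ω l)⁻¹ - |θ l|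
        = (weight ω l * |θ l| - 1 / 2) ^ 2 / weight ω l + 3 / 4 / weight ω l := by
      field_simp; ring
    have : 0 ≤ (weight ω l * |θ l| - 1 / 2) ^ 2 / weight ω l + 3 / 4 / weight ω l := by positivity
    linarith
  have hsum := Summable.of_nonneg_of_le (fun l => abs_nonneg (θ l)) hle (hθ.1.add hs)
  refine ⟨hsum, (hsum.tsum_le_tsum hle (hθ.1.add hs)).trans ?_⟩
  rw [hθ.1.tsum_add hs]
  exact add_le_add_left hθ.2 _

/-- A function of the ellipsoid is continuous, bounded uniformly over the ellipsoid, and has the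
expected Fourier coefficients. -/
lemma sobolev_properties {ω Q : ℝ} (hω : 0 < ω) {f : ℝ → ℝ} {θ : ℕ → ℝ}
    (hθ : θ ∈ coefEllipsoid ω Q) (hf : ∀ t, HasSum (fun l => θ l * trigBasis l t) (f t)) :
    Continuous f ∧ (∀ t, |f t| ≤ Q + ∑' l, (weight ω l)⁻¹) ∧ ∀ l, fourierCoef f l = θ l := by
  obtain ⟨hs, hb⟩ := summable_abs_coef hω hθ
  have hle : ∀ l t, ‖θ l * trigBasis l t‖ ≤ |θ l| := fun l t => by
    rw [norm_mul, Real.norm_eq_abs, Real.norm_eq_abs]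
    exact mul_le_of_le_one_right (abs_nonneg _) (abs_trigBasis_le_one l t)
  have hfe : f = fun t => ∑' l, θ l * trigBasis l t := funext fun t => (hf t).tsum_eq.symm
  refine ⟨?_, fun t => ?_, fun l => ?_⟩
  · rw [hfe]
    exact continuous_tsum (fun l => (continuous_trigBasis l).const_mul _) hs hle
  · rw [hfe]
    exact (tsum_of_norm_bounded hs.hasSum fun l => hle l t).trans hb
  · have h := intervalIntegral.hasSum_integral_of_dominated_convergence
      (μ := volume) (a := -Real.pi) (b := Real.pi)
      (F := fun k t => θ k * trigBasis k t * trigBasis l t) (f := fun t => f t * trigBasis l t)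
      (fun k _ => |θ k|) (fun k => Continuous.aestronglyMeasurable
        (((continuous_trigBasis k).const_mul _).mul (continuous_trigBasis l)))
      (fun k => ae_of_all _ fun t _ => by
        rw [norm_mul]
        exact mul_le_of_le_one_right (norm_nonneg _) (abs_trigBasis_le_one l t) |>.trans (hle k t))
      (ae_of_all _ fun t _ => hs) intervalIntegrable_const
      (ae_of_all _ fun t _ => (hf t).mul_right _)
    simp only [mul_assoc, intervalIntegral.integral_const_mul, integral_trigBasis_mul] at h
    have h2 : HasSum (fun k => θ k * if k = l then 1 else 0) (θ l) := by
      simpa [mul_ite] using hasSum_single (f := fun k => θ k * if k = l then 1 else 0) l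
        fun k hk => by simp [hk]
    exact h.unique h2

end Ellipsoid

/-! ### Step functions on `[-π, π]` -/

section StepFunctions

open Real

/-- The step function `∑ c i 1_{(-∞, i]}`: integrating it over `[-π, π]` against the differential
of a path `y` with `y (-π) = 0` gives `∑ c i y i`. -/
def stepFun (I : Finset (Set.Icc (-π) π)) (c : Set.Icc (-π) π → ℝ) (u : ℝ) : ℝ :=
  ∑ i ∈ I, c i * {x : ℝ | x ≤ i}.indicator 1 u

lemma memLp_indicator_le (i : ℝ) :
    MemLp ({x : ℝ | x ≤ i}.indicator (1 : ℝ → ℝ)) 2 (volume.restrict (Set.Ioc (-π) π)) :=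
  (memLp_const (1 : ℝ)).indicator measurableSet_Iic

lemma memLp_stepFun (I : Finset (Set.Icc (-π) π)) (c : Set.Icc (-π) π → ℝ) :
    MemLp (stepFun I c) 2 (volume.restrict (Set.Ioc (-π) π)) :=
  memLp_finsetSum _ fun i _ => (memLp_indicator_le i).const_mul (c i)

lemma memLp_of_continuous {f : ℝ → ℝ} (hf : Continuous f) :
    MemLp f 2 (volume.restrict (Set.Ioc (-π) π)) := by
  refine (memLp_two_iff_integrable_sq hf.aestronglyMeasurable).2 ?_
  exact ((by fun_prop : Continuous fun x => f x ^ 2).integrableOn_Icc).mono_set Set.Ioc_subset_Icc_self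

lemma neg_pi_le_pi : -π ≤ π := by linarith [pi_pos]

lemma integral_mul_stepFun {f : ℝ → ℝ} (hf : Continuous f) (I : Finset (Set.Icc (-π) π))
    (c : Set.Icc (-π) π → ℝ) :
    ∫ u in (-π)..π, f u * stepFun I c u = ∑ i ∈ I, c i * ∫ u in (-π)..(i : ℝ), f u := by
  have h : ∀ i : Set.Icc (-π) π, c i * ∫ u in (-π)..(i : ℝ), f u
      = ∫ u in (-π)..π, f u * (c i * {x : ℝ | x ≤ i}.indicator 1 u) := fun i => by
    rw [← intervalIntegral.integral_indicator i.2, ← intervalIntegral.integral_const_mul]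
    refine intervalIntegral.integral_congr fun u _ => ?_
    by_cases hu : u ≤ i <;> simp [hu, mul_comm]
  simp only [h, stepFun, Finset.mul_sum]
  refine intervalIntegral.integral_finsetSum fun i _ => ?_
  rw [intervalIntegrable_iff_integrableOn_Ioc_of_le neg_pi_le_pi]
  exact (memLp_of_continuous hf).integrable_mul ((memLp_indicator_le i).const_mul (c i))

lemma integral_stepFun_sq (I : Finset (Set.Icc (-π) π)) (c : Set.Icc (-π) π → ℝ) :
    ∫ u in (-π)..π, stepFun I c u ^ 2 = ∑ i ∈ I, ∑ j ∈ I, c i * c j * (min (i : ℝ) j + π) := by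
  have h := integral_sum_mul_sq (P := volume.restrict (Set.Ioc (-π) π))
    (X := fun i : Set.Icc (-π) π => {x : ℝ | x ≤ i}.indicator (1 : ℝ → ℝ))
    (fun i => memLp_indicator_le i) I c
  rw [intervalIntegral.integral_of_le neg_pi_le_pi]
  refine h.trans ?_
  refine Finset.sum_congr rfl fun i _ => Finset.sum_congr rfl fun j _ => ?_
  congr 1
  rw [← intervalIntegral.integral_of_le neg_pi_le_pi]
  have hm : min (i : ℝ) j ∈ Set.Icc (-π) π := ⟨le_min i.2.1 j.2.1, min_le_of_left_le i.2.2⟩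
  have e : ∀ u : ℝ, {x : ℝ | x ≤ i}.indicator (1 : ℝ → ℝ) u * {x : ℝ | x ≤ j}.indicator 1 u
      = {x : ℝ | x ≤ min (i : ℝ) j}.indicator (fun _ => 1) u := fun u => by
    by_cases h1 : u ≤ i <;> by_cases h2 : u ≤ j <;> simp [h1, h2]
  simp only [e]
  rw [intervalIntegral.integral_indicator hm]
  simp

/-- Riemann sums: a continuous function is uniformly close on `(-π, π]` to a step function. -/
lemma exists_stepFun_near {φ : ℝ → ℝ} (hφ : Continuous φ) {ε : ℝ} (hε : 0 < ε) :
    ∃ I c, ∀ u ∈ Set.Ioc (-π) π, |stepFun I c u - φ u| ≤ ε := by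
  classical
  have huc : UniformContinuousOn φ (Set.Icc (-π) π) :=
    isCompact_Icc.uniformContinuousOn_of_continuous hφ.continuousOn
  obtain ⟨δ, hδ, hd⟩ := Metric.uniformContinuousOn_iff.1 huc ε hε
  obtain ⟨m, hm⟩ := exists_nat_gt (2 * π / δ)
  have hπ := pi_pos
  have hm0 : (0 : ℝ) < m := lt_trans (by positivity) hm
  set s : ℝ := 2 * π / m with hs
  have hs0 : 0 < s := by positivity
  have hsδ : s < δ := by rw [hs, div_lt_iff₀ hm0]; rwa [div_lt_iff₀' hδ] at hm
  have hms : m * s = 2 * π := by rw [hs]; field_simp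
  let U : Set.Icc (-π) π → ℝ → ℝ := fun i => {x : ℝ | x ≤ i}.indicator 1
  let p : ℕ → ℝ := fun k => -π + k * s
  have hp : ∀ k ≤ m, p k ∈ Set.Icc (-π) π := fun k hk => by
    have h1 : (k : ℝ) * s ≤ m * s := by
      have : (k : ℝ) ≤ m := by exact_mod_cast hk
      gcongr
    have h2 : 0 ≤ (k : ℝ) * s := by positivity
    exact ⟨by simp only [p]; linarith, by simp only [p]; linarith⟩
  let h : ℝ → ℝ := ∑ k : Fin m, φ (p (k + 1)) •
    (U ⟨p (k + 1), by exact_mod_cast hp (k + 1) k.2⟩ - U ⟨p k, hp k k.2.le⟩)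
  have hmem : h ∈ Submodule.span ℝ (Set.range U) :=
    Submodule.sum_mem _ fun k _ => Submodule.smul_mem _ _ (Submodule.sub_mem _
      (Submodule.subset_span ⟨_, rfl⟩) (Submodule.subset_span ⟨_, rfl⟩))
  obtain ⟨c, hc⟩ := Finsupp.mem_span_range_iff_exists_finsupp.1 hmem
  refine ⟨c.support, c, fun u hu => ?_⟩
  have hstep : stepFun c.support c u = h u := by
    rw [← hc, Finsupp.sum, Finset.sum_apply]
    rfl
  -- the cell `(p k, p (k + 1)]` that contains `u`
  set q : ℕ := ⌈(u + π) / s⌉₊ with hq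
  have hu0 : 0 < (u + π) / s := div_pos (by linarith [hu.1]) hs0
  have hq0 : 0 < q := Nat.ceil_pos.2 hu0
  have hqm : q ≤ m := Nat.ceil_le.2 (by rw [div_le_iff₀ hs0, hms]; linarith [hu.2])
  have hle : ∀ k : ℕ, u ≤ p k ↔ q ≤ k := fun k => by
    rw [hq, Nat.ceil_le, div_le_iff₀ hs0]
    simp only [p]
    constructor <;> intro h <;> linarith
  have hval : h u = φ (p q) := by
    simp only [h, Finset.sum_apply, Pi.smul_apply, Pi.sub_apply, smul_eq_mul, U,
      Set.indicator_apply, Set.mem_ofPred_eq, Pi.one_apply]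
    rw [Finset.sum_eq_single (⟨q - 1, by omega⟩ : Fin m)]
    · have e : q - 1 + 1 = q := by omega
      simp only [hle, e, le_refl, if_true, if_neg (by omega : ¬ q ≤ q - 1)]
      simp
    · intro k _ hk
      have hk' : (k : ℕ) ≠ q - 1 := fun h => hk (Fin.ext h)
      simp only [hle]
      by_cases h1 : q ≤ k
      · rw [if_pos h1, if_pos (by omega)]; simp
      · rw [if_neg h1, if_neg (by omega)]; simp
    · simp
  rw [hstep, hval, ← Real.dist_eq]
  refine (hd (p q) (hp q hqm) u (Set.Ioc_subset_Icc_self hu) ?_).le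
  have h1 : u ≤ p q := (hle q).2 le_rfl
  have h2 : ¬ u ≤ p (q - 1) := fun h => by have := (hle (q - 1)).1 h; omega
  have h3 : p q = p (q - 1) + s := by
    simp only [p]; rw [Nat.cast_sub hq0]; push_cast; ring
  rw [Real.dist_eq, abs_of_nonneg (by linarith)]
  linarith

end StepFunctions

/-! ### The white noise model -/

section WhiteNoise

open Real

variable {Ω : Type*} [MeasurableSpace Ω] {P : Measure Ω} {B : ℝ≥0 → Ω → ℝ}

/-- The noise `n^{-1/2} B` of the white noise model, as a process on `[-π, π]`. -/
def pathNoise (B : ℝ≥0 → Ω → ℝ) (n : ℕ) (t : Set.Icc (-π) π) (w : Ω) : ℝ :=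
  (√(n : ℝ))⁻¹ * B (Real.toNNReal (t + π)) w

lemma whiteNoisePath_apply {Ω : Type*} (B : ℝ≥0 → Ω → ℝ) (n : ℕ) (f : ℝ → ℝ) (w : Ω)
    (t : Set.Icc (-π) π) :
    whiteNoisePath B n f w t = (∫ u in (-π)..(t : ℝ), f u) + pathNoise B n t w := rfl

lemma isGaussianProcess_pathNoise (hB : IsBrownianReal B P) (n : ℕ) :
    IsGaussianProcess (pathNoise B n) P :=
  (hB.isGaussianProcess.comp_right fun t : Set.Icc (-π) π => Real.toNNReal (t + π)).smul
    fun _ => (√(n : ℝ))⁻¹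

lemma integral_pathNoise (hB : IsBrownianReal B P) (n : ℕ) (t : Set.Icc (-π) π) :
    P[pathNoise B n t] = 0 := by
  unfold pathNoise
  rw [integral_const_mul, hB.integral_eval, mul_zero]

/-- The Itô isometry for step functions. -/
lemma integral_sum_pathNoise_sq (hB : IsBrownianReal B P) (n : ℕ) (I : Finset (Set.Icc (-π) π))
    (c : Set.Icc (-π) π → ℝ) :
    ∫ w, (∑ i ∈ I, c i * pathNoise B n i w) ^ 2 ∂P
      = (n : ℝ)⁻¹ * ∫ u in (-π)..π, stepFun I c u ^ 2 := by
  have hX := isGaussianProcess_pathNoise hB n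
  have := hX.isProbabilityMeasure
  have hG : ∀ t, MemLp (B t) 2 P := fun t => (hB.isGaussianProcess.hasGaussianLaw_eval t).memLp_two
  rw [integral_sum_mul_sq fun i => (hX.hasGaussianLaw_eval i).memLp_two, integral_stepFun_sq,
    Finset.mul_sum]
  refine Finset.sum_congr rfl fun i _ => ?_
  rw [Finset.mul_sum]
  refine Finset.sum_congr rfl fun j _ => ?_
  have h := hB.covariance_eval (Real.toNNReal (i + π)) (Real.toNNReal (j + π))
  rw [covariance_eq_sub (hG _) (hG _), hB.integral_eval, zero_mul, sub_zero] at h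
  have e : ∀ w, pathNoise B n i w * pathNoise B n j w
      = (n : ℝ)⁻¹ * (B (Real.toNNReal (i + π)) * B (Real.toNNReal (j + π))) w := fun w => by
    have hsq : (√(n : ℝ))⁻¹ * (√(n : ℝ))⁻¹ = (n : ℝ)⁻¹ := by
      rw [← mul_inv, Real.mul_self_sqrt (Nat.cast_nonneg n)]
    rw [← hsq]
    simp only [pathNoise, Pi.mul_apply]; ring
  simp only [e]
  rw [integral_const_mul, h, NNReal.coe_min, Real.coe_toNNReal _ (by linarith [i.2.1]),
    Real.coe_toNNReal _ (by linarith [j.2.1]), min_add_add_right]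
  ring

lemma measurable_pathNoise (hBm : ∀ t, Measurable (B t)) (n : ℕ) (t : Set.Icc (-π) π) :
    Measurable (pathNoise B n t) := (hBm _).const_mul _

lemma whiteNoiseMinimaxRisk_lower (hBm : ∀ t, Measurable (B t)) (hB : IsBrownianReal B P)
    {ω Q L : ℝ} (hω : 0 < ω) (hQ : 0 < Q) (hL : 0 < L) {n N : ℕ} (hn : 0 < n) (hN : 0 < N) :
    ENNReal.ofReal (N * (n * (1 + L⁻¹))⁻¹) ≤ whiteNoiseMinimaxRisk P B ω Q n + ENNReal.ofReal
      (4 * (∫⁻ t, ENNReal.ofReal (t ^ 4) ∂(gaussianReal 0 1)).toReal * N ^ 3 * weight ω N * L ^ 2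
        / (n ^ 2 * Q)) := by
  have hn' : (0 : ℝ) < n := by exact_mod_cast hn
  rw [← tsub_le_iff_right]
  refine le_iInf₂ fun T hT => ?_
  rw [tsub_le_iff_right]
  refine minimax_lower_bound (isGaussianProcess_pathNoise hB n) (measurable_pathNoise hBm n)
    (integral_pathNoise hB n) hn hN
    (v := fun j t => ∫ u in (-π)..(t : ℝ), trigBasis j u) ?_ hT hQ hL fun x hx => ?_
  · -- Bessel's inequality
    intro j I c
    rw [integral_sum_pathNoise_sq hB, ← mul_assoc, mul_inv_cancel₀ hn'.ne', one_mul,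
      ← integral_mul_stepFun (continuous_trigBasis j)]
    set b := ∫ u in (-π)..π, trigBasis j u * stepFun I c u with hb
    have hφ := memLp_of_continuous (continuous_trigBasis j)
    have hs := memLp_stepFun I c
    have h1 := integral_trigBasis_mul j j
    rw [if_pos rfl] at h1
    -- `b • φ_j` is the projection of the step function onto `φ_j`
    have h0 : 0 ≤ ∫ u in (-π)..π, (stepFun I c u - b * trigBasis j u) ^ 2 :=
      intervalIntegral.integral_nonneg neg_pi_le_pi fun u _ => sq_nonneg _
    have e : ∀ u, (stepFun I c u - b * trigBasis j u) ^ 2 = stepFun I c u ^ 2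
        - 2 * b * (trigBasis j u * stepFun I c u) + b ^ 2 * (trigBasis j u * trigBasis j u) :=
      fun u => by ring
    simp only [e] at h0
    have i1 : IntervalIntegrable (fun u => stepFun I c u ^ 2) volume (-π) π := by
      rw [intervalIntegrable_iff_integrableOn_Ioc_of_le neg_pi_le_pi]; exact hs.integrable_sq
    have i2 : IntervalIntegrable (fun u => 2 * b * (trigBasis j u * stepFun I c u))
        volume (-π) π := by
      rw [intervalIntegrable_iff_integrableOn_Ioc_of_le neg_pi_le_pi]
      exact (hφ.integrable_mul hs).const_mul _
    have i3 : IntervalIntegrable (fun u => b ^ 2 * (trigBasis j u * trigBasis j u))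
        volume (-π) π := by
      rw [intervalIntegrable_iff_integrableOn_Ioc_of_le neg_pi_le_pi]
      exact (hφ.integrable_mul hφ).const_mul _
    rw [intervalIntegral.integral_add (i1.sub i2) i3, intervalIntegral.integral_sub i1 i2,
      intervalIntegral.integral_const_mul, intervalIntegral.integral_const_mul, h1, ← hb] at h0
    nlinarith
  · set f : ℝ → ℝ := fun t => ∑ j : Fin N, x j * trigBasis j t with hf
    have hsum : ∀ t, HasSum (fun l => extendZero x l * trigBasis l t) (f t) := fun t => by
      have h : HasSum (fun l => extendZero x l * trigBasis l t)
          (∑ l ∈ Finset.range N, extendZero x l * trigBasis l t) :=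
        hasSum_sum_of_ne_finset_zero fun l hl => by
          rw [extendZero_of_le x (by simpa using hl), zero_mul]
      rw [Finset.sum_range] at h
      simpa only [extendZero_coe] using h
    have hfm : f ∈ sobolevEllipsoid ω Q := ⟨extendZero x, hx, hsum⟩
    refine le_trans (le_of_eq ?_) (le_iSup₂ (f := fun f _ => whiteNoiseRisk P B n T f) f hfm)
    unfold whiteNoiseRisk
    refine tsum_congr fun l => lintegral_congr fun w => ?_
    rw [(sobolev_properties hω hx hsum).2.2 l]
    congr 4
    ext t
    have h := intervalIntegral.integral_finsetSum (μ := volume) (a := -π) (b := (t : ℝ))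
      (s := Finset.univ) (f := fun (j : Fin N) u => x j * trigBasis j u) fun j _ =>
      ((continuous_trigBasis j).const_mul (x j)).intervalIntegrable _ _
    simp only [intervalIntegral.integral_const_mul] at h
    rw [whiteNoisePath_apply, hf, h]

/-- Riemann sums for `∫ φ_l dY` along the observed path estimate a Fourier coefficient with risk
arbitrarily close to `n⁻¹`, uniformly over the ellipsoid. -/
lemma exists_linear_estimator (hB : IsBrownianReal B P)
    {ω Q η : ℝ} (hω : 0 < ω) (hη : 0 < η) {n : ℕ} (hn : 0 < n) (l : ℕ) :
    ∃ T : (Set.Icc (-π) π → ℝ) → ℝ, Measurable T ∧ ∀ f ∈ sobolevEllipsoid ω Q,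
      ∫⁻ w, ENNReal.ofReal ((T (whiteNoisePath B n f w) - fourierCoef f l) ^ 2) ∂P
        ≤ ENNReal.ofReal ((n : ℝ)⁻¹ + η) := by
  have hX := isGaussianProcess_pathNoise hB n
  have := hX.isProbabilityMeasure
  set K := Q + ∑' l, (weight ω l)⁻¹ with hK
  have hn' : (0 : ℝ) < n := by exact_mod_cast hn
  -- the uniform distance of the step function to `φ_l`, small enough for squared bias plus variance
  obtain ⟨ε, hε, hε'⟩ : ∃ ε > 0, (2 * π * |K| * ε) ^ 2 + (n : ℝ)⁻¹ * (1 + 2 * π * (2 * ε + ε ^ 2))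
      ≤ (n : ℝ)⁻¹ + η := by
    have hc : Continuous fun ε : ℝ => (2 * π * |K| * ε) ^ 2
        + (n : ℝ)⁻¹ * (1 + 2 * π * (2 * ε + ε ^ 2)) := by fun_prop
    have ht := (hc.tendsto 0).mono_left (nhdsWithin_le_nhds (s := Set.Ioi 0))
    have hlt : (2 * π * |K| * 0) ^ 2 + (n : ℝ)⁻¹ * (1 + 2 * π * (2 * 0 + 0 ^ 2))
        < (n : ℝ)⁻¹ + η := by simp [hη]
    obtain ⟨ε, h1, h2⟩ := ((ht.eventually (gt_mem_nhds hlt)).and self_mem_nhdsWithin).exists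
    exact ⟨ε, h2, h1.le⟩
  obtain ⟨I, c, hIc⟩ := exists_stepFun_near (continuous_trigBasis l) hε
  have hs := memLp_stepFun I c
  refine ⟨fun y => ∑ i ∈ I, c i * y i, by fun_prop, fun f ⟨θ, hθ, hf⟩ => ?_⟩
  obtain ⟨hfc, hfb, -⟩ := sobolev_properties hω hθ hf
  set Z : Ω → ℝ := fun w => ∑ i ∈ I, c i * pathNoise B n i w with hZ
  have hZL : MemLp Z 2 P :=
    memLp_finsetSum _ fun i _ => (hX.hasGaussianLaw_eval i).memLp_two.const_mul (c i)
  have hZ0 : ∫ w, Z w ∂P = 0 := by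
    rw [hZ, integral_finsetSum _ fun i _ =>
      ((hX.hasGaussianLaw_eval i).memLp_two.integrable one_le_two).const_mul (c i)]
    exact Finset.sum_eq_zero fun i _ => by rw [integral_const_mul, integral_pathNoise hB, mul_zero]
  set b := ∫ u in (-π)..π, f u * (stepFun I c u - trigBasis l u) with hb
  have ifs : IntervalIntegrable (fun u => f u * stepFun I c u) volume (-π) π := by
    rw [intervalIntegrable_iff_integrableOn_Ioc_of_le neg_pi_le_pi]
    exact (memLp_of_continuous hfc).integrable_mul hs
  have e : ∀ w, (∑ i ∈ I, c i * whiteNoisePath B n f w i) - fourierCoef f l = b + Z w := fun w => by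
    simp only [whiteNoisePath_apply, mul_add, Finset.sum_add_distrib]
    rw [← integral_mul_stepFun hfc, hb, fourierCoef]
    simp only [mul_sub]
    have ifφ : IntervalIntegrable (fun u => f u * trigBasis l u) volume (-π) π :=
      (hfc.mul (continuous_trigBasis l)).intervalIntegrable _ _
    rw [intervalIntegral.integral_sub ifs ifφ]
    ring
  have hbias : |b| ≤ 2 * π * |K| * ε := by
    have h := intervalIntegral.norm_integral_le_of_norm_le_const (a := -π) (b := π)
      (C := |K| * ε) (f := fun u => f u * (stepFun I c u - trigBasis l u)) fun u hu => by
        rw [Set.uIoc_of_le neg_pi_le_pi] at hu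
        rw [norm_mul]
        exact mul_le_mul ((hfb u).trans (le_abs_self K)) (hIc u hu) (norm_nonneg _) (abs_nonneg _)
    rw [Real.norm_eq_abs, abs_of_nonneg (by linarith [pi_pos] : 0 ≤ π - -π)] at h
    calc |b| ≤ |K| * ε * (π - -π) := h
      _ = 2 * π * |K| * ε := by ring
  have hvar : ∫ u in (-π)..π, stepFun I c u ^ 2 ≤ 1 + 2 * π * (2 * ε + ε ^ 2) := by
    have h1 := integral_trigBasis_mul l l
    rw [if_pos rfl] at h1
    have i1 : IntervalIntegrable (fun u => stepFun I c u ^ 2) volume (-π) π := by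
      rw [intervalIntegrable_iff_integrableOn_Ioc_of_le neg_pi_le_pi]; exact hs.integrable_sq
    have i2 : IntervalIntegrable (fun u => trigBasis l u * trigBasis l u) volume (-π) π :=
      ((continuous_trigBasis l).mul (continuous_trigBasis l)).intervalIntegrable _ _
    calc ∫ u in (-π)..π, stepFun I c u ^ 2
        ≤ ∫ u in (-π)..π, (trigBasis l u * trigBasis l u + (2 * ε + ε ^ 2)) := by
          refine intervalIntegral.integral_mono_on_of_le_Ioo neg_pi_le_pi i1
            (i2.add intervalIntegrable_const) fun u hu => ?_
          have h2 := hIc u (Set.Ioo_subset_Ioc_self hu)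
          have h3 := abs_trigBasis_le_one l u
          set d := stepFun I c u - trigBasis l u with hd
          have h4 : stepFun I c u = trigBasis l u + d := by rw [hd]; ring
          rw [h4]
          have h5 : trigBasis l u * d ≤ 1 * ε := (le_abs_self _).trans (by
            rw [abs_mul]; exact mul_le_mul h3 h2 (abs_nonneg _) zero_le_one)
          have h6 : d ^ 2 ≤ ε ^ 2 := sq_le_sq' (abs_le.1 h2).1 (abs_le.1 h2).2
          nlinarith
      _ = 1 + 2 * π * (2 * ε + ε ^ 2) := by
          rw [intervalIntegral.integral_add i2 intervalIntegrable_const, h1,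
            intervalIntegral.integral_const, smul_eq_mul]
          ring
  simp only [e]
  have hi : Integrable (fun w => (b + Z w) ^ 2) P := ((memLp_const b).add hZL).integrable_sq
  rw [← ofReal_integral_eq_lintegral_ofReal hi (ae_of_all _ fun w => sq_nonneg _)]
  refine ENNReal.ofReal_le_ofReal (le_trans ?_ hε')
  have e2 : ∀ w, (b + Z w) ^ 2 = b ^ 2 + 2 * b * Z w + Z w ^ 2 := fun w => by ring
  simp only [e2]
  have j1 : Integrable (fun w => b ^ 2 + 2 * b * Z w) P :=
    (integrable_const _).add ((hZL.integrable one_le_two).const_mul _)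
  rw [integral_add j1 hZL.integrable_sq, integral_add (integrable_const _)
    ((hZL.integrable one_le_two).const_mul _), integral_const_mul, hZ0, hZ,
    integral_sum_pathNoise_sq hB]
  have h7 : b ^ 2 ≤ (2 * π * |K| * ε) ^ 2 := sq_le_sq' (abs_le.1 hbias).1 (abs_le.1 hbias).2
  have h8 := mul_le_mul_of_nonneg_left hvar (inv_pos.2 hn').le
  simp only [integral_const, measure_univ, measureReal_def, ENNReal.toReal_one, one_smul,
    mul_zero, add_zero]
  linarith

lemma whiteNoiseMinimaxRisk_upper (hB : IsBrownianReal B P)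
    {ω Q : ℝ} (hω : 0 < ω) (hQ : 0 < Q) {n : ℕ} (hn : 0 < n) (N : ℕ) :
    whiteNoiseMinimaxRisk P B ω Q n ≤ ENNReal.ofReal (N / n + Q / weight ω N) := by
  have := hB.isGaussianProcess.isProbabilityMeasure
  have hw := weight_pos ω N
  have key : ∀ η > 0, whiteNoiseMinimaxRisk P B ω Q n
      ≤ ENNReal.ofReal (N * ((n : ℝ)⁻¹ + η) + Q / weight ω N) := fun η hη => by
    choose T hTm hT using fun l => exists_linear_estimator (Q := Q) hB hω hη hn l
    have hT' : Measurable fun (y : Set.Icc (-π) π → ℝ) (l : ℕ) => if l < N then T l y else 0 := by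
      refine measurable_pi_lambda _ fun l => ?_
      split_ifs
      · exact hTm l
      · exact measurable_const
    refine iInf₂_le_of_le _ hT' (iSup₂_le fun f hf => ?_)
    obtain ⟨θ, hθ, hfs⟩ := id hf
    refine (tsum_risk_le hθ (N := N) (e := ENNReal.ofReal ((n : ℝ)⁻¹ + η)) (fun l hl => ?_)
      fun l hl => ?_).trans (le_of_eq ?_)
    · simp only [hl, if_true]
      exact hT l f hf
    · simp [not_lt.2 hl, (sobolev_properties hω hθ hfs).2.2 l]
    · rw [← ENNReal.ofReal_natCast, ← ENNReal.ofReal_mul (by positivity),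
        ← ENNReal.ofReal_add (by positivity) (by positivity)]
  have hc : Continuous fun η : ℝ => ENNReal.ofReal (N * ((n : ℝ)⁻¹ + η) + Q / weight ω N) :=
    ENNReal.continuous_ofReal.comp (by fun_prop)
  have ht := (hc.tendsto 0).mono_left (nhdsWithin_le_nhds (s := Set.Ioi 0))
  rw [add_zero, ← div_eq_mul_inv] at ht
  exact ge_of_tendsto ht (Filter.mem_of_superset self_mem_nhdsWithin key)

end WhiteNoise

/-! ### Asymptotics of the two bounds -/

section Asymptotics

lemma freq_two_mul (k : ℕ) : freq (2 * k) = k := by unfold freq; omega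

/-- Matching of the two bounds. The upper one is used with all the coefficients below the first
frequency `k` whose weight `exp (k² ω² / 2)` reaches `n`, so that the tail costs at most `Q / n`.
The lower one is used up to the fraction `1 - δ` of that frequency, where the weight is at most
`n ^ (1 - δ)²`, with `L = δ⁻¹`; then `n → ∞` and `δ → 0`. -/
lemma tendsto_div_rate {ω Q C : ℝ} (hω : 0 < ω) (hQ : 0 < Q) (hC : 0 ≤ C) {R : ℕ → ℝ≥0∞}
    (hup : ∀ n : ℕ, 0 < n → ∀ N : ℕ, R n ≤ ENNReal.ofReal (N / n + Q / weight ω N))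
    (hlow : ∀ L : ℝ, 0 < L → ∀ n : ℕ, 0 < n → ∀ N : ℕ, 0 < N →
      ENNReal.ofReal (N * (n * (1 + L⁻¹))⁻¹) ≤ R n + ENNReal.ofReal
        (C * N ^ 3 * weight ω N * L ^ 2 / (n ^ 2 * Q))) :
    Tendsto (fun n => (R n).toReal / rate ω n) atTop (𝓝 1) := by
  set g : ℝ := 2 * √2 * ω⁻¹ with hg
  have hg0 : 0 < g := by positivity
  set s : ℕ → ℝ := fun n => √(Real.log n) with hs
  have hlog : Tendsto (fun n : ℕ => Real.log n) atTop atTop :=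
    Real.tendsto_log_atTop.comp tendsto_natCast_atTop_atTop
  have hst : Tendsto s atTop atTop := Real.tendsto_sqrt_atTop.comp hlog
  have hs2 : ∀ n : ℕ, 0 < n → s n ^ 2 = Real.log n := fun n hn =>
    Real.sq_sqrt (Real.log_nonneg (by exact_mod_cast hn))
  have hrate : ∀ n, rate ω n = g * s n / n := fun n => by
    simp only [rate, hg, hs]; ring
  have hfin : ∀ n, 0 < n → R n ≠ ∞ := fun n hn =>
    ne_top_of_le_ne_top ENNReal.ofReal_ne_top (hup n hn 0)
  have hev : ∀ᶠ n : ℕ in atTop, 0 < n ∧ 0 < s n :=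
    (eventually_gt_atTop 0).and (hst.eventually_gt_atTop 0)
  have hinv : Tendsto (fun n => (s n)⁻¹) atTop (𝓝 0) := tendsto_inv_atTop_zero.comp hst
  have hupper : ∀ᶠ n in atTop, (R n).toReal / rate ω n ≤ 1 + (2 + Q) / g * (s n)⁻¹ := by
    filter_upwards [hev] with n ⟨hn, hsn⟩
    have hn' : (0 : ℝ) < n := by exact_mod_cast hn
    -- `g / 2 * s n = √(2 log n) / ω` is the frequency of weight exactly `n`
    set k := ⌈g / 2 * s n⌉₊ with hk
    have hk1 : g / 2 * s n ≤ k := Nat.le_ceil _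
    have hk2 : (k : ℝ) < g / 2 * s n + 1 := Nat.ceil_lt_add_one (by positivity)
    have hw : (n : ℝ) ≤ weight ω (2 * k) := by
      rw [weight, freq_two_mul, ← Real.exp_log hn', ← hs2 n hn]
      apply Real.exp_le_exp.2
      have h1 : (g / 2 * s n) ^ 2 ≤ (k : ℝ) ^ 2 := by gcongr
      have h2 : (g / 2 * s n) ^ 2 * ω ^ 2 / 2 = s n ^ 2 := by
        rw [hg]
        have : √(2 : ℝ) ^ 2 = 2 := Real.sq_sqrt (by norm_num)
        field_simp
        rw [this]
      rw [← h2]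
      gcongr
    have h := ENNReal.toReal_le_of_le_ofReal
      (add_nonneg (by positivity) (div_nonneg hQ.le (weight_pos ω _).le)) (hup n hn (2 * k))
    have h3 : Q / weight ω (2 * k) ≤ Q / n := by gcongr
    rw [hrate, div_le_iff₀ (by positivity)]
    have h4 : (1 + (2 + Q) / g * (s n)⁻¹) * (g * s n / n) = (g * s n + 2 + Q) / n := by
      field_simp; ring
    rw [h4]
    calc (R n).toReal ≤ _ := h
      _ ≤ ((2 * k : ℕ) : ℝ) / n + Q / n := by gcongr
      _ ≤ (g * s n + 2 + Q) / n := by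
        rw [← add_div]
        gcongr
        push_cast
        linarith
  have hlower : ∀ δ : ℝ, 0 < δ → δ < 1 → ∀ᶠ n in atTop,
      ((1 - δ) - 2 / g * (s n)⁻¹) / (1 + δ) - C * g ^ 2 * δ⁻¹ ^ 2 / Q *
        (s n ^ 2 * Real.exp (-(1 - (1 - δ) ^ 2) * s n ^ 2)) ≤ (R n).toReal / rate ω n := by
    intro δ hδ hδ1
    filter_upwards [hev] with n ⟨hn, hsn⟩
    have hn' : (0 : ℝ) < n := by exact_mod_cast hn
    set k := ⌊(1 - δ) * (g / 2 * s n)⌋₊ with hk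
    have hpos : 0 ≤ (1 - δ) * (g / 2 * s n) := mul_nonneg (by linarith) (by positivity)
    have hk1 : (k : ℝ) ≤ (1 - δ) * (g / 2 * s n) := Nat.floor_le hpos
    have hk2 : (1 - δ) * (g / 2 * s n) < k + 1 := Nat.lt_floor_add_one _
    have hw : weight ω (2 * k) ≤ Real.exp ((1 - δ) ^ 2 * s n ^ 2) := by
      rw [weight, freq_two_mul]
      apply Real.exp_le_exp.2
      have h1 : (k : ℝ) ^ 2 ≤ ((1 - δ) * (g / 2 * s n)) ^ 2 := by gcongr
      have h2 : ((1 - δ) * (g / 2 * s n)) ^ 2 * ω ^ 2 / 2 = (1 - δ) ^ 2 * s n ^ 2 := by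
        rw [hg]
        have : √(2 : ℝ) ^ 2 = 2 := Real.sq_sqrt (by norm_num)
        field_simp
        rw [this]
      rw [← h2]
      gcongr
    have hkg : ((2 * k : ℕ) : ℝ) ≤ g * s n := by
      push_cast
      nlinarith [mul_pos hg0 hsn]
    have hr0 : 0 < rate ω n := by rw [hrate]; positivity
    have hw0 := weight_pos ω (2 * k)
    have hb : ((2 * k : ℕ) : ℝ) * (n * (1 + δ))⁻¹ ≤ (R n).toReal +
        C * ((2 * k : ℕ) : ℝ) ^ 3 * weight ω (2 * k) * δ⁻¹ ^ 2 / (n ^ 2 * Q) := by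
      rcases Nat.eq_zero_or_pos k with h0 | h0
      · rw [h0]
        simp
      · have h := hlow δ⁻¹ (by positivity) n hn (2 * k) (by omega)
        rw [inv_inv, ← ENNReal.ofReal_toReal (hfin n hn),
          ← ENNReal.ofReal_add ENNReal.toReal_nonneg (by positivity)] at h
        exact (ENNReal.ofReal_le_ofReal_iff (by positivity)).1 h
    have hexp : Real.exp (-(1 - (1 - δ) ^ 2) * s n ^ 2) = Real.exp ((1 - δ) ^ 2 * s n ^ 2) / n := by
      rw [eq_div_iff hn'.ne']
      conv_lhs => rw [← Real.exp_log hn', ← hs2 n hn, ← Real.exp_add]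
      congr 1; ring
    rw [le_div_iff₀ hr0, sub_mul, sub_le_iff_le_add]
    calc ((1 - δ) - 2 / g * (s n)⁻¹) / (1 + δ) * rate ω n
        = ((1 - δ) * (g * s n) - 2) * (n * (1 + δ))⁻¹ := by
          rw [hrate]; field_simp
      _ ≤ ((2 * k : ℕ) : ℝ) * (n * (1 + δ))⁻¹ := by
          gcongr
          push_cast
          linarith
      _ ≤ _ := hb
      _ ≤ (R n).toReal + C * (g * s n) ^ 3 * Real.exp ((1 - δ) ^ 2 * s n ^ 2) * δ⁻¹ ^ 2
            / (n ^ 2 * Q) := by gcongr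
      _ = _ := by
          rw [hrate, hexp]; field_simp
  refine tendsto_order.2 ⟨fun a ha => ?_, fun a ha => ?_⟩
  · have hcδ : Tendsto (fun δ : ℝ => (1 - δ) / (1 + δ)) (𝓝[>] 0) (𝓝 1) := by
      have : ContinuousAt (fun δ : ℝ => (1 - δ) / (1 + δ)) 0 :=
        ContinuousAt.div (by fun_prop) (by fun_prop) (by norm_num)
      have h := this.tendsto.mono_left (nhdsWithin_le_nhds (s := Set.Ioi 0))
      simpa using h
    obtain ⟨δ, hδa, hδ0, hδ1⟩ := ((hcδ.eventually (lt_mem_nhds ha)).and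
      (Ioo_mem_nhdsGT (zero_lt_one' ℝ))).exists
    have hc : 0 < 1 - (1 - δ) ^ 2 := by nlinarith
    have hx := (tendsto_rpow_mul_exp_neg_mul_atTop_nhds_zero 1 _ hc).comp
      ((tendsto_pow_atTop two_ne_zero).comp hst)
    simp only [Function.comp_def, Real.rpow_one] at hx
    have hlim := (((tendsto_const_nhds (x := 1 - δ)).sub (hinv.const_mul (2 / g))).div_const
      (1 + δ)).sub (hx.const_mul (C * g ^ 2 * δ⁻¹ ^ 2 / Q))
    simp only [mul_zero, sub_zero] at hlim
    filter_upwards [hlower δ hδ0 hδ1, hlim.eventually (lt_mem_nhds hδa)] with n h1 h2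
    exact h2.trans_le h1
  · have hlim := (hinv.const_mul ((2 + Q) / g)).const_add 1
    rw [mul_zero, add_zero] at hlim
    filter_upwards [hupper, hlim.eventually (gt_mem_nhds ha)] with n h1 h2
    exact h1.trans_lt h2

end Asymptotics

end InfSobolev

end

theorem theorem1 (ω Q : ℝ) (hω : 0 < ω) (hQ : 0 < Q) :
    Tendsto (fun n : ℕ => (InfSobolev.sequenceMinimaxRisk ω Q n).toReal / InfSobolev.rate ω n)
      atTop (𝓝 1) ∧
    ∀ {Ω : Type*} [MeasurableSpace Ω] (P : Measure Ω) (B : ℝ≥0 → Ω → ℝ),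
      (∀ t, Measurable (B t)) → IsBrownianReal B P →
      Tendsto
        (fun n : ℕ => (InfSobolev.whiteNoiseMinimaxRisk P B ω Q n).toReal / InfSobolev.rate ω n)
        atTop (𝓝 1) := by
  have hC : 0 ≤ 4 * (∫⁻ t, ENNReal.ofReal (t ^ 4) ∂(gaussianReal 0 1)).toReal := by positivity
  refine ⟨InfSobolev.tendsto_div_rate hω hQ hC
    (fun n hn N => InfSobolev.sequenceMinimaxRisk_upper ω Q hn N)
    fun L hL n hn N hN => InfSobolev.sequenceMinimaxRisk_lower hQ hL hn hN, ?_⟩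
  intro Ω _ P B hBm hB
  exact InfSobolev.tendsto_div_rate hω hQ hC
    (fun n hn N => InfSobolev.whiteNoiseMinimaxRisk_upper hB hω hQ hn N)
    fun L hL n hn N hN => InfSobolev.whiteNoiseMinimaxRisk_lower hBm hB hω hQ hL hn hN
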